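/- Structures and theories are those of (possibly many-sorted) first-order logic, with nonempty sorts. A structure $N$ is interpreted by a structure $M$ (with parameters) if every sort of $N$ is the image of a set of finite tuples of $M$, definable in $M$ with parameters, under a map such that the preimages of equality on $N$, of the relations of $N$ and of the graphs of the functions of $N$ are definable in $M$ with parameters. A theory $T$ interprets an infinite linear order if some model of $T$ interprets, with parameters, some infinite linear order $(X,<)$. In a monster model $\mathfrak C$ of a theory (a $\kappa$-saturated model, where $\kappa$ is larger than $\aleph_0$ and the number of sorts and symbols of the language; "small" means of size $<\kappa$), the Lascar distance $d_L(a,b)$ of two small, possibly infinite, tuples $a,b$ with the same index set is the least $n\in\mathbb N$ for which there are tuples $a=a_0,a_1,\dots,a_n=b$ and elementary substructures $M_1,\dots,M_n\preceq\mathfrak C$ such that $a_{i-1}$ and $a_i$ have the same type over $M_i$ for $i=1,\dots,n$; it is $\infty$ if there is no such $n$. A theory is G-compact if every Lascar strong type has finite diameter, i.e. if for every small tuple $a$ of a monster model there is $n\in\mathbb N$ such that, for all $b$, $d_L(a,b)<\infty$ implies $d_L(a,b)\le n$. A theory $T$ is hereditarily G-compact if for every model $M$ of $T$ and every structure $N$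 interpreted by $M$ (with parameters), the theory $\mathrm{Th}(N)$ is G-compact. **Theorem.** Let $T$ be a first-order theory that interprets an infinite linear order. Then $T$ is not hereditarily G-compact. -/

import Mathlib

/-! Many-sorted first-order logic, interpretations with parameters, Lascar distance and
(hereditary) G-compactness. Structures may have any number of sorts. -/

universe u

namespace ManySorted

open Cardinal

/-- `Var Γ s` is the type of positions in the list of sorts `Γ` that carry the sort `s`, i.e. of the
variables of sort `s` in the finite context `Γ`. -/
inductive Var {S : Type u} : List S → S → Type u
  | zero {s : S} {Γ : List S} : Var (s :: Γ) s
  | succ {s t : S} {Γ : List S} : Var Γ s → Var (t :: Γ) s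

/-- A many-sorted first-order language: a set of sorts, function symbols (with a list of argument
sorts and a value sort; constants have the empty list) and relation symbols. -/
structure Lang where
  Srt : Type u
  Fun : List Srt → Srt → Type u
  Rel : List Srt → Type u

namespace Lang

/-- The number of sorts and symbols of the language. -/
noncomputable def card (L : Lang.{u}) : Cardinal.{u} :=
  #L.Srt + #(Σ ar : List L.Srt, Σ s : L.Srt, L.Fun ar s) + #(Σ ar : List L.Srt, L.Rel ar)

/-- Terms of sort `s` with variables in the context `Γ`. -/
inductive Term (L : Lang.{u}) (Γ : List L.Srt) : L.Srt → Type u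
  | var {s : L.Srt} (x : Var Γ s) : Term L Γ s
  | app {ar : List L.Srt} {s : L.Srt} (f : L.Fun ar s)
      (ts : ∀ t : L.Srt, Var ar t → Term L Γ t) : Term L Γ s

/-- First-order formulas with free variables in the context `Γ`. -/
inductive Formula (L : Lang.{u}) : List L.Srt → Type u
  | falsum {Γ : List L.Srt} : Formula L Γ
  | eq {Γ : List L.Srt} {s : L.Srt} (t₁ t₂ : L.Term Γ s) : Formula L Γ
  | rel {Γ ar : List L.Srt} (R : L.Rel ar) (ts : ∀ t : L.Srt, Var ar t → L.Term Γ t) : Formula L Γ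
  | imp {Γ : List L.Srt} (φ ψ : Formula L Γ) : Formula L Γ
  | all {Γ : List L.Srt} (s : L.Srt) (φ : Formula L (s :: Γ)) : Formula L Γ

/-- Sentences are formulas without free variables. -/
abbrev Sentence (L : Lang.{u}) : Type u := L.Formula []

/-- A theory is a set of sentences. -/
abbrev Theory (L : Lang.{u}) : Type u := Set L.Sentence

/-- A many-sorted structure; as usual every sort is nonempty. -/
structure Str (L : Lang.{u}) where
  carrier : L.Srt → Type u
  nonempty : ∀ s, Nonempty (carrier s)
  funMap : ∀ {ar : List L.Srt} {s : L.Srt}, L.Fun ar s → (∀ t, Var ar t → carrier t) → carrier s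
  relMap : ∀ {ar : List L.Srt}, L.Rel ar → (∀ t, Var ar t → carrier t) → Prop

/-- Tuples of elements of `M` indexed by a sorted index set `V`: the entries whose index lies in
`V s` are elements of sort `s`. -/
abbrev Str.Tuple {L : Lang.{u}} (M : L.Str) (V : L.Srt → Type*) : Type _ :=
  ∀ s, V s → M.carrier s

/-- Adding one entry in front of a finite tuple. -/
def Str.cons {L : Lang.{u}} (M : L.Str) {Γ : List L.Srt} {s : L.Srt} (a : M.carrier s)
    (e : M.Tuple (Var Γ)) : M.Tuple (Var (s :: Γ))
  | _, .zero => a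
  | _, .succ x => e _ x

/-- The value of a term. -/
def Term.realize {L : Lang.{u}} (M : L.Str) {Γ : List L.Srt} (e : M.Tuple (Var Γ)) :
    ∀ {s : L.Srt}, L.Term Γ s → M.carrier s
  | _, .var x => e _ x
  | _, .app f ts => M.funMap f (fun t x => (ts t x).realize M e)

/-- Satisfaction of a formula in `M` under an assignment. -/
def Formula.Realize {L : Lang.{u}} (M : L.Str) :
    ∀ {Γ : List L.Srt}, L.Formula Γ → M.Tuple (Var Γ) → Prop
  | _, .falsum, _ => False
  | _, .eq t₁ t₂, e => t₁.realize M e = t₂.realize M e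
  | _, .rel R ts, e => M.relMap R (fun t x => (ts t x).realize M e)
  | _, .imp φ ψ, e => φ.Realize M e → ψ.Realize M e
  | _, .all s φ, e => ∀ a : M.carrier s, φ.Realize M (M.cons a e)

/-- The empty assignment. -/
def Str.nil {L : Lang.{u}} (M : L.Str) : M.Tuple (Var []) :=
  fun _ x => nomatch x

/-- `M` is a model of `T`. -/
def Str.IsModel {L : Lang.{u}} (M : L.Str) (T : L.Theory) : Prop :=
  ∀ φ ∈ T, φ.Realize M M.nil

/-- The complete theory `Th(M)`. -/
def Str.theory {L : Lang.{u}} (M : L.Str) : L.Theory :=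
  {φ | φ.Realize M M.nil}

/-- A family of maps `M → C` is an elementary embedding; its image is then an elementary
substructure of `C`, and every elementary substructure arises in this way. -/
def Str.IsElementary {L : Lang.{u}} (M C : L.Str) (f : ∀ s, M.carrier s → C.carrier s) : Prop :=
  ∀ (Γ : List L.Srt) (φ : L.Formula Γ) (e : M.Tuple (Var Γ)),
    φ.Realize C (fun s x => f s (e s x)) ↔ φ.Realize M e

/-- The tuples `a` and `b` (possibly infinite) have the same type over the parameters listed by
`p`. -/
def Str.SameTypeOver {L : Lang.{u}} (C : L.Str) {P V : L.Srt → Type u} (p : C.Tuple P)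
    (a b : C.Tuple V) : Prop :=
  ∀ (Γ : List L.Srt) (φ : L.Formula Γ) (σ : ∀ s, Var Γ s → V s ⊕ P s),
    φ.Realize C (fun s x => Sum.elim (a s) (p s) (σ s x)) ↔
      φ.Realize C (fun s x => Sum.elim (b s) (p s) (σ s x))

/-- There are `a = a₀, …, aₙ = b` and elementary substructures `M₁, …, Mₙ` of `C` such that
`aᵢ₋₁` and `aᵢ` have the same type over `Mᵢ`. -/
def Str.LascarChain {L : Lang.{u}} (C : L.Str) {V : L.Srt → Type u} (n : ℕ)
    (a b : C.Tuple V) : Prop :=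
  ∃ c : ℕ → C.Tuple V, c 0 = a ∧ c n = b ∧
    ∀ i < n, ∃ (M : L.Str) (f : ∀ s, M.carrier s → C.carrier s),
      M.IsElementary C f ∧ C.SameTypeOver f (c i) (c (i + 1))

/-- The Lascar distance: the least length of a chain as above, and `⊤` if there is none. -/
noncomputable def Str.lascarDist {L : Lang.{u}} (C : L.Str) {V : L.Srt → Type u}
    (a b : C.Tuple V) : ℕ∞ :=
  sInf {d : ℕ∞ | ∃ n : ℕ, d = n ∧ C.LascarChain n a b}

/-- `C` is `κ`-saturated: if `A` is a set of fewer than `κ` elements, and `p` is a set of formulas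
in one variable (of sort `s`) with parameters from `A` that is finitely satisfiable in `C`, then
`p` is realized in `C`. -/
def Str.IsSaturated {L : Lang.{u}} (C : L.Str) (κ : Cardinal.{u}) : Prop :=
  ∀ A : ∀ s, Set (C.carrier s), #(Σ s, A s) < κ →
    ∀ (s : L.Srt) (p : Set (Σ Γ : List L.Srt, L.Formula (s :: Γ) × (∀ t, Var Γ t → A t))),
      (∀ q : Finset (Σ Γ : List L.Srt, L.Formula (s :: Γ) × (∀ t, Var Γ t → A t)), ↑q ⊆ p →
        ∃ a : C.carrier s, ∀ ψ ∈ q, ψ.2.1.Realize C (C.cons a (fun t x => (ψ.2.2 t x).1))) →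
      ∃ a : C.carrier s, ∀ ψ ∈ p, ψ.2.1.Realize C (C.cons a (fun t x => (ψ.2.2 t x).1))

/-- `T` is G-compact: in a monster model of `T`, every Lascar strong type (of a possibly infinite
small tuple `a`) has finite diameter. Monster models are taken to be the `κ`-saturated models with
`κ > |L| + ℵ₀`, and small means of size `< κ`. As the Lascar distance is defined by types (and not
by automorphisms), strong homogeneity is not involved: the distance of two small tuples of a
`κ`-saturated `C` does not change when `C` is replaced by a larger elementary extension. -/
def Theory.IsGCompact {L : Lang.{u}} (T : L.Theory) : Prop :=
  ∀ (κ : Cardinal.{u}), L.card + ℵ₀ < κ →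
    ∀ C : L.Str, C.IsModel T → C.IsSaturated κ →
      ∀ V : L.Srt → Type u, #(Σ s, V s) < κ →
        ∀ a : C.Tuple V, ∃ n : ℕ, ∀ b : C.Tuple V, C.lascarDist a b < ⊤ → C.lascarDist a b ≤ n

/-- A set of tuples of `M` is definable in `M` with parameters: it is the set of solutions of a
formula into some of whose variables elements of `M` have been substituted. -/
def Str.IsDefinable {L : Lang.{u}} (M : L.Str) {V : L.Srt → Type u} (X : Set (M.Tuple V)) : Prop :=
  ∃ (Γ : List L.Srt) (φ : L.Formula Γ) (σ : ∀ s, Var Γ s → V s ⊕ M.carrier s),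
    ∀ e : M.Tuple V, e ∈ X ↔ φ.Realize M (fun s x => Sum.elim (e s) id (σ s x))

/-- The sorted index set of a list of blocks of variables: one block of shape `ctx t` for each
entry `t` of the list `ar`. -/
abbrev Blocks {S S' : Type u} (ctx : S' → List S) (ar : List S') : S → Type u :=
  fun s => Σ t : S', Var ar t × Var (ctx t) s

/-- The block at position `x` of a tuple of blocks. -/
def Str.block {L : Lang.{u}} (M : L.Str) {S' : Type u} {ctx : S' → List L.Srt} {ar : List S'}
    (e : M.Tuple (Blocks ctx ar)) (t : S') (x : Var ar t) : M.Tuple (Var (ctx t)) :=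
  fun s y => e s ⟨t, x, y⟩

/-- An interpretation, with parameters, of the structure `N` in the structure `M`. Every sort `t` of
`N` is the image, under `coord t`, of a definable set `dom t` of finite tuples of `M`, such that the
preimages of equality, of the relations and of the graphs of the functions of `N` are definable
in `M` with parameters. (The values of `coord t` outside `dom t` are irrelevant.) -/
structure Interpretation {L L' : Lang.{u}} (M : L.Str) (N : L'.Str) where
  ctx : L'.Srt → List L.Srt
  dom : ∀ t, Set (M.Tuple (Var (ctx t)))
  coord : ∀ t, M.Tuple (Var (ctx t)) → N.carrier t
  surj : ∀ t (y : N.carrier t), ∃ e ∈ dom t, coord t e = y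
  dom_def : ∀ t, M.IsDefinable (dom t)
  eq_def : ∀ t, M.IsDefinable {e : M.Tuple (Blocks ctx [t, t]) |
    (∀ t' x, M.block e t' x ∈ dom t') ∧
      coord t (M.block e t .zero) = coord t (M.block e t (.succ .zero))}
  rel_def : ∀ (ar : List L'.Srt) (R : L'.Rel ar), M.IsDefinable {e : M.Tuple (Blocks ctx ar) |
    (∀ t x, M.block e t x ∈ dom t) ∧ N.relMap R (fun t x => coord t (M.block e t x))}
  fun_def : ∀ (ar : List L'.Srt) (t : L'.Srt) (f : L'.Fun ar t),
    M.IsDefinable {e : M.Tuple (Blocks ctx (t :: ar)) |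
      (∀ t' x, M.block e t' x ∈ dom t') ∧
        N.funMap f (fun t' x => coord t' (M.block e t' (.succ x))) = coord t (M.block e t .zero)}

/-- `T` is hereditarily G-compact: for every model `M` of `T` and every (many-sorted) structure `N`
interpreted by `M` with parameters, `Th(N)` is G-compact. -/
def Theory.IsHereditarilyGCompact {L : Lang.{u}} (T : L.Theory) : Prop :=
  ∀ M : L.Str, M.IsModel T → ∀ (L' : Lang.{u}) (N : L'.Str),
    Nonempty (Interpretation M N) → N.theory.IsGCompact

/-- The only symbol of the language of orders is the binary relation symbol `<`. -/
inductive OrderRel : List PUnit.{u + 1} → Type u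
  | lt : OrderRel [PUnit.unit, PUnit.unit]

/-- The one-sorted language of orders. -/
def order : Lang.{u} where
  Srt := PUnit.{u + 1}
  Fun := fun _ _ => PEmpty.{u + 1}
  Rel := OrderRel

/-- A nonempty strict order `(X, <)` as a one-sorted structure. -/
def orderStr (X : Type u) [LT X] [Nonempty X] : order.{u}.Str where
  carrier := fun _ => X
  nonempty := fun _ => inferInstance
  funMap := fun f _ => nomatch f
  relMap := fun R e => match R with
    | .lt => e PUnit.unit .zero < e PUnit.unit (.succ .zero)

/-- `T` interprets an infinite linear order: some model of `T` interprets, with parameters, an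
infinite linear order. -/
def Theory.InterpretsInfiniteLinearOrder {L : Lang.{u}} (T : L.Theory) : Prop :=
  ∃ M : L.Str, M.IsModel T ∧
    ∃ (X : Type u) (_ : LinearOrder X) (_ : Infinite X), Nonempty (Interpretation M (orderStr X))

end Lang

end ManySorted

namespace ManySorted

/-! ### Variables -/

namespace Var

variable {S : Type u}

/-! Let `J` be a linear order. For every `n` arrange `2 * n + 2` copies of `J` on a circle, with the
binary relation "the second point is less than one turn of `J` ahead of the first". These circles,
one in each sort, form `circStr J`. If `J` is a definable subset of an interpreted infinite order
`X`, then `circStr J` is interpreted too: a point is a pair consisting of an element of `J` and a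
parameter of `X` that codes the copy (`circInterpretation`). It remains to choose `J` so that the
theory of the circles is not G-compact.

Lower bound. Finitely many points cover a circle, in the sense that each point is less than a turn
ahead of one of them. Hence every elementary submodel contains such a cover, and two points with the
same type over it are ahead of a common point. A Lascar step therefore changes the label of the copy
by at most one (`labelNear_of_lascarChain`), and opposite points of the circle `n` are at distance
greater than `n`.

Upper bound. Cutting the circle at the copies of a point `c` turns it into labelled copies of the
interval from `c` to the next `c` in `ℤ ×ₗ J`. If this order is dense, or discrete without ends, a
back-and-forth argument shows that truth of formulas depends only on labels and truncated distances
(`Sim.realize_iff`). If in addition two positions fill the same cut over a sufficiently dense set of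
positions, that set gives an elementary submodel over which points at these positions with equal
labels have the same type (`exists_elementary_sameTypeOver`). With one cutting point `d` moves to
`d'`, with another `d'` moves on to the next copy of `d`; alternating the two walks around the whole
circle in finitely many Lascar steps. This is what `Movable d d'` provides.

Consequently, in an `ℵ₁`-saturated ultrapower, the tuple with one base point in each sort can be
moved to the opposite point in the sort `n` alone. All these tuples have the same Lascar strong
type, but their distances from the base tuple are unbounded (`circStr_not_isGCompact`).

Choice of `J`. If the finite closed intervals of `X` have bounded size, the elements without
immediate predecessor are densely ordered, and a half-open interval of them serves
(`exists_movable_of_bounded`). Otherwise an ultraproduct of larger and larger finite intervals is an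
infinite discrete interval of the ultrapower of `X`, which is interpreted in an ultrapower of the
given model (`exists_movable_of_unbounded`). -/

theorem finite_sigma (Γ : List S) : Finite (Σ s, Var Γ s) := by
  induction Γ with
  | nil => exact Finite.of_surjective (fun x : Empty => x.elim) (fun ⟨_, x⟩ => nomatch x)
  | cons t Γ ih =>
    refine Finite.of_surjective
      (fun x : Option (Σ s, Var Γ s) => (match x with
        | none => ⟨t, .zero⟩
        | some y => ⟨y.1, .succ y.2⟩ : Σ s, Var (t :: Γ) s)) ?_
    rintro ⟨s, x⟩
    cases x with
    | zero => exact ⟨none, rfl⟩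
    | succ y => exact ⟨some ⟨s, y⟩, rfl⟩

instance (Γ : List S) : Finite (Σ s, Var Γ s) := finite_sigma Γ

instance (Γ : List S) (s : S) : Finite (Var Γ s) :=
  Finite.of_injective (fun x => (⟨s, x⟩ : Σ s, Var Γ s)) fun _ _ h => by simpa using h

/-- The variables of the left part of a concatenation. -/
def inl {Δ : List S} : ∀ {Γ : List S} {s : S}, Var Γ s → Var (Γ ++ Δ) s
  | _ :: _, _, .zero => .zero
  | _ :: _, _, .succ x => .succ x.inl

/-- The variables of the right part of a concatenation. -/
def inr {Δ : List S} : ∀ {Γ : List S} {s : S}, Var Δ s → Var (Γ ++ Δ) s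
  | [], _, x => x
  | _ :: Γ, _, x => .succ (inr (Γ := Γ) x)

/-- A variable of a concatenation lies in one of the two parts. -/
def split {Δ : List S} : ∀ {Γ : List S} {s : S}, Var (Γ ++ Δ) s → Var Γ s ⊕ Var Δ s
  | [], _, x => .inr x
  | _ :: _, _, .zero => .inl .zero
  | _ :: Γ, _, .succ x => (split (Γ := Γ) x).map .succ id

@[simp] theorem split_inl {Δ : List S} : ∀ {Γ : List S} {s : S} (x : Var Γ s),
    (x.inl : Var (Γ ++ Δ) s).split = .inl x
  | _ :: _, _, .zero => rfl
  | _ :: _, _, .succ x => by simp [inl, split, split_inl x]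

@[simp] theorem split_inr {Δ : List S} : ∀ {Γ : List S} {s : S} (x : Var Δ s),
    (x.inr : Var (Γ ++ Δ) s).split = .inr x
  | [], _, _ => rfl
  | _ :: Γ, _, x => by simp [inr, split, split_inr (Γ := Γ) x]

/-- Extending a renaming by a new first variable. -/
def lift {Γ Δ : List S} (ρ : ∀ s, Var Γ s → Var Δ s) (t : S) :
    ∀ s, Var (t :: Γ) s → Var (t :: Δ) s
  | _, .zero => .zero
  | _, .succ x => .succ (ρ _ x)

end Var

/-! ### Renaming, finite disjunctions and blocks of quantifiers -/

namespace Lang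

variable {L : Lang.{u}}

theorem Str.cons_comp_lift (M : L.Str) {Γ Δ : List L.Srt} (ρ : ∀ s, Var Γ s → Var Δ s)
    {t : L.Srt} (a : M.carrier t) (e : M.Tuple (Var Δ)) :
    (fun s x => M.cons a e s (Var.lift ρ t s x)) = M.cons a (fun s x => e s (ρ s x)) := by
  funext s x
  cases x <;> rfl

theorem Str.cons_comp (M C : L.Str) (f : ∀ s, M.carrier s → C.carrier s) {Γ : List L.Srt}
    {t : L.Srt} (a : M.carrier t) (e : M.Tuple (Var Γ)) :
    (fun s x => f s (M.cons a e s x)) = C.cons (f t a) (fun s x => f s (e s x)) := by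
  funext s x
  cases x <;> rfl

/-- Renaming the variables of a term. -/
def Term.rename {Γ Δ : List L.Srt} (ρ : ∀ s, Var Γ s → Var Δ s) :
    ∀ {s : L.Srt}, L.Term Γ s → L.Term Δ s
  | _, .var x => .var (ρ _ x)
  | _, .app f ts => .app f fun t x => (ts t x).rename ρ

theorem Term.realize_rename (M : L.Str) {Γ Δ : List L.Srt} (ρ : ∀ s, Var Γ s → Var Δ s)
    (e : M.Tuple (Var Δ)) : ∀ {s : L.Srt} (t : L.Term Γ s),
    (t.rename ρ).realize M e = t.realize M (fun s x => e s (ρ s x))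
  | _, .var x => rfl
  | _, .app f ts => by
    simp only [rename, realize]
    congr 1
    funext t x
    exact realize_rename M ρ e (ts t x)

/-- Renaming the free variables of a formula. -/
def Formula.rename : ∀ {Γ Δ : List L.Srt}, (∀ s, Var Γ s → Var Δ s) → L.Formula Γ → L.Formula Δ
  | _, _, _, .falsum => .falsum
  | _, _, ρ, .eq t₁ t₂ => .eq (t₁.rename ρ) (t₂.rename ρ)
  | _, _, ρ, .rel R ts => .rel R fun t x => (ts t x).rename ρ
  | _, _, ρ, .imp φ ψ => .imp (φ.rename ρ) (ψ.rename ρ)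
  | _, _, ρ, .all s φ => .all s (φ.rename (Var.lift ρ s))

theorem Formula.realize_rename (M : L.Str) : ∀ {Γ Δ : List L.Srt} (ρ : ∀ s, Var Γ s → Var Δ s)
    (φ : L.Formula Γ) (e : M.Tuple (Var Δ)),
    (φ.rename ρ).Realize M e ↔ φ.Realize M (fun s x => e s (ρ s x))
  | _, _, _, .falsum, _ => Iff.rfl
  | _, _, ρ, .eq t₁ t₂, e => by
    simp only [rename, Realize, Term.realize_rename]
  | _, _, ρ, .rel R ts, e => by
    simp only [rename, Realize, Term.realize_rename]
  | _, _, ρ, .imp φ ψ, e => by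
    simp only [rename, Realize, realize_rename M ρ φ e, realize_rename M ρ ψ e]
  | _, _, ρ, .all s φ, e => by
    simp only [rename, Realize]
    refine forall_congr' fun a => ?_
    rw [realize_rename M _ φ, Str.cons_comp_lift]

/-- Negation. -/
def Formula.not {Γ : List L.Srt} (φ : L.Formula Γ) : L.Formula Γ := .imp φ .falsum

/-- Existential quantification. -/
def Formula.ex {Γ : List L.Srt} (s : L.Srt) (φ : L.Formula (s :: Γ)) : L.Formula Γ :=
  (Formula.all s φ.not).not

@[simp] theorem Formula.realize_not (M : L.Str) {Γ : List L.Srt} (φ : L.Formula Γ)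
    (e : M.Tuple (Var Γ)) : φ.not.Realize M e ↔ ¬ φ.Realize M e := Iff.rfl

@[simp] theorem Formula.realize_ex (M : L.Str) {Γ : List L.Srt} {s : L.Srt}
    (φ : L.Formula (s :: Γ)) (e : M.Tuple (Var Γ)) :
    (φ.ex s).Realize M e ↔ ∃ a, φ.Realize M (M.cons a e) := by
  simp [Formula.ex, Formula.Realize]

/-- Finite disjunctions exist. -/
theorem Formula.exists_disj {ι : Type*} [Finite ι] {Γ : List L.Srt} (f : ι → L.Formula Γ) :
    ∃ φ : L.Formula Γ, ∀ (M : L.Str) (e : M.Tuple (Var Γ)),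
      φ.Realize M e ↔ ∃ i, (f i).Realize M e := by
  classical
  cases nonempty_fintype ι
  suffices H : ∀ s : Finset ι, ∃ φ : L.Formula Γ, ∀ (M : L.Str) (e : M.Tuple (Var Γ)),
      φ.Realize M e ↔ ∃ i ∈ s, (f i).Realize M e by simpa using H Finset.univ
  intro s
  induction s using Finset.induction_on with
  | empty => exact ⟨.falsum, by simp [Formula.Realize]⟩
  | insert i s _ ih =>
    obtain ⟨φ, hφ⟩ := ih
    refine ⟨.imp (f i).not φ, fun M e => ?_⟩
    simp only [Formula.Realize, hφ, realize_not, Finset.mem_insert, exists_eq_or_imp]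
    tauto

/-- Existential quantification over all variables of the left part of the context. -/
def Formula.exs {Δ : List L.Srt} : ∀ {Γ : List L.Srt}, L.Formula (Γ ++ Δ) → L.Formula Δ
  | [], φ => φ
  | s :: Γ, φ => exs (Γ := Γ) (φ.ex s)

/-- The concatenation of two finite tuples. -/
def Str.append (M : L.Str) {Γ Δ : List L.Srt} (y : M.Tuple (Var Γ)) (e : M.Tuple (Var Δ)) :
    M.Tuple (Var (Γ ++ Δ)) :=
  fun s x => Sum.elim (y s) (e s) x.split

@[simp] theorem Str.append_inl (M : L.Str) {Γ Δ : List L.Srt} (y : M.Tuple (Var Γ))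
    (e : M.Tuple (Var Δ)) {s : L.Srt} (x : Var Γ s) : M.append y e s x.inl = y s x := by
  simp [Str.append]

@[simp] theorem Str.append_inr (M : L.Str) {Γ Δ : List L.Srt} (y : M.Tuple (Var Γ))
    (e : M.Tuple (Var Δ)) {s : L.Srt} (x : Var Δ s) : M.append y e s x.inr = e s x := by
  simp [Str.append]

theorem Str.cons_append (M : L.Str) {Γ Δ : List L.Srt} {s : L.Srt} (a : M.carrier s)
    (y : M.Tuple (Var Γ)) (e : M.Tuple (Var Δ)) :
    M.append (M.cons a y) e = M.cons a (M.append y e) := by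
  funext t x
  cases x with
  | zero => rfl
  | succ x =>
    simp only [append, Var.split, cons]
    cases x.split <;> rfl

theorem Formula.realize_exs (M : L.Str) {Δ : List L.Srt} (e : M.Tuple (Var Δ)) :
    ∀ {Γ : List L.Srt} (φ : L.Formula (Γ ++ Δ)),
    φ.exs.Realize M e ↔ ∃ y : M.Tuple (Var Γ), φ.Realize M (M.append y e)
  | [], φ => ⟨fun h => ⟨M.nil, h⟩, fun ⟨_, h⟩ => h⟩
  | s :: Γ, φ => by
    rw [exs, realize_exs M e (Γ := Γ)]
    constructor
    · rintro ⟨y, h⟩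
      obtain ⟨a, h⟩ := (realize_ex M _ _).1 h
      exact ⟨M.cons a y, by rwa [Str.cons_append]⟩
    · rintro ⟨y, h⟩
      refine ⟨fun t x => y t x.succ, (realize_ex M _ _).2 ⟨y s .zero, ?_⟩⟩
      have hy : M.cons (y s .zero) (fun t x => y t x.succ) = y := by
        funext t x
        cases x <;> rfl
      rw [← hy, Str.cons_append] at h
      exact h

/-! ### Definable sets -/

namespace Str.IsDefinable

variable {M : L.Str} {V W : L.Srt → Type u}

theorem compl {X : Set (M.Tuple V)} (h : M.IsDefinable X) : M.IsDefinable Xᶜ := by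
  obtain ⟨Γ, φ, σ, h⟩ := h
  exact ⟨Γ, φ.not, σ, fun e => by simp [h]⟩

theorem empty : M.IsDefinable (∅ : Set (M.Tuple V)) :=
  ⟨[], .falsum, fun _ x => (nomatch x), fun e => by simp [Formula.Realize]⟩

theorem union {X Y : Set (M.Tuple V)} (hX : M.IsDefinable X) (hY : M.IsDefinable Y) :
    M.IsDefinable (X ∪ Y) := by
  obtain ⟨Γ, φ, σ, hX⟩ := hX
  obtain ⟨Δ, ψ, τ, hY⟩ := hY
  refine ⟨Γ ++ Δ, .imp (φ.rename fun _ => Var.inl).not (ψ.rename fun _ => Var.inr),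
    fun s x => Sum.elim (σ s) (τ s) x.split, fun e => ?_⟩
  simp only [Set.mem_union, hX, hY, Formula.Realize, Formula.realize_not, Formula.realize_rename,
    Var.split_inl, Var.split_inr, Sum.elim_inl, Sum.elim_inr]
  tauto

theorem inter {X Y : Set (M.Tuple V)} (hX : M.IsDefinable X) (hY : M.IsDefinable Y) :
    M.IsDefinable (X ∩ Y) := by
  rw [← compl_compl (X ∩ Y), Set.compl_inter]
  exact (hX.compl.union hY.compl).compl

theorem iUnion {ι : Type*} [Finite ι] {X : ι → Set (M.Tuple V)} (h : ∀ i, M.IsDefinable (X i)) :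
    M.IsDefinable (⋃ i, X i) := by
  classical
  cases nonempty_fintype ι
  suffices H : ∀ s : Finset ι, M.IsDefinable (⋃ i ∈ s, X i) by simpa using H Finset.univ
  intro s
  induction s using Finset.induction_on with
  | empty => simpa using empty
  | insert i s _ ih => simpa using (h i).union ih

/-- Substituting variables and parameters. -/
theorem subst {X : Set (M.Tuple V)} (h : M.IsDefinable X)
    (q : ∀ s, V s → W s ⊕ M.carrier s) :
    M.IsDefinable {e : M.Tuple W | (fun s x => Sum.elim (e s) id (q s x) : M.Tuple V) ∈ X} := by
  obtain ⟨Γ, φ, σ, h⟩ := h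
  refine ⟨Γ, φ, fun s x => Sum.elim (q s) .inr (σ s x), fun e => ?_⟩
  rw [Set.mem_ofPred_eq, h]
  refine iff_of_eq (congrArg _ ?_)
  funext s x
  simp only
  rcases σ s x <;> rfl

theorem reindex {X : Set (M.Tuple V)} (h : M.IsDefinable X) (q : ∀ s, V s → W s) :
    M.IsDefinable {e : M.Tuple W | (fun s x => e s (q s x) : M.Tuple V) ∈ X} :=
  h.subst fun s x => .inl (q s x)

theorem exists_tuple {Γ : List L.Srt} {X : Set (M.Tuple fun s => V s ⊕ Var Γ s)}
    (h : M.IsDefinable X) :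
    M.IsDefinable {e : M.Tuple V | ∃ y : M.Tuple (Var Γ),
      (fun s => Sum.elim (e s) (y s) : M.Tuple fun s => V s ⊕ Var Γ s) ∈ X} := by
  obtain ⟨Δ, φ, σ, h⟩ := h
  let ρ : ∀ s, Var Δ s → Var (Γ ++ Δ) s := fun s x =>
    match σ s x with
    | .inl (.inr y) => y.inl
    | _ => x.inr
  let τ : ∀ s, Var Δ s → V s ⊕ M.carrier s := fun s x =>
    match σ s x with
    | .inl (.inl v) => .inl v
    -- A dummy value: `ρ` sends these variables to the quantified block, so it is never read.
    | .inl (.inr _) => .inr (M.nonempty s).some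
    | .inr m => .inr m
  refine ⟨Δ, (φ.rename ρ).exs, τ, fun e => ?_⟩
  rw [Set.mem_ofPred_eq, Formula.realize_exs]
  refine exists_congr fun y => ?_
  rw [h, Formula.realize_rename]
  refine iff_of_eq (congrArg _ ?_)
  funext s x
  simp only [ρ]
  cases hx : σ s x with
  | inl z =>
    cases z with
    | inl v => simp [τ, hx]
    | inr v => simp
  | inr m => simp [τ, hx]

end Str.IsDefinable

/-! ### Elementary embeddings -/

/-- The Tarski–Vaught test, for languages without function symbols. -/
theorem Str.isElementary_of_tarskiVaught [∀ ar s, IsEmpty (L.Fun ar s)] {M C : L.Str}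
    {f : ∀ s, M.carrier s → C.carrier s} (hinj : ∀ s, Function.Injective (f s))
    (hrel : ∀ (ar : List L.Srt) (R : L.Rel ar) (e : M.Tuple (Var ar)),
      C.relMap R (fun s x => f s (e s x)) ↔ M.relMap R e)
    (h : ∀ (Γ : List L.Srt) (s : L.Srt) (φ : L.Formula (s :: Γ)) (e : M.Tuple (Var Γ))
      (a : C.carrier s), φ.Realize C (C.cons a fun s x => f s (e s x)) →
      ∃ a' : M.carrier s, φ.Realize C (C.cons (f s a') fun s x => f s (e s x))) :
    M.IsElementary C f := by
  have hterm : ∀ {Γ : List L.Srt} {s : L.Srt} (t : L.Term Γ s) (e : M.Tuple (Var Γ)),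
      t.realize C (fun s x => f s (e s x)) = f s (t.realize M e) := by
    intro Γ s t e
    cases t with
    | var x => rfl
    | app g ts => exact isEmptyElim g
  intro Γ φ
  induction φ with
  | falsum => exact fun e => Iff.rfl
  | eq t₁ t₂ =>
    intro e
    simp only [Formula.Realize, hterm]
    exact (hinj _).eq_iff
  | rel R ts =>
    intro e
    simp only [Formula.Realize, hterm]
    exact hrel _ R fun s x => (ts s x).realize M e
  | imp φ ψ ihφ ihψ =>
    intro e
    simp only [Formula.Realize, ihφ, ihψ]
  | all s φ ih =>
    intro e
    simp only [Formula.Realize]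
    constructor
    · intro H a
      rw [← ih, Str.cons_comp]
      exact H _
    · intro H
      by_contra! hc
      obtain ⟨a, ha⟩ := hc
      obtain ⟨a', ha'⟩ := h _ s φ.not e a ha
      refine ha' ?_
      have := (ih (M.cons a' e)).2 (H a')
      rwa [Str.cons_comp] at this

theorem Str.IsElementary.comp {M N C : L.Str} {f : ∀ s, M.carrier s → N.carrier s}
    {g : ∀ s, N.carrier s → C.carrier s} (hf : M.IsElementary N f) (hg : N.IsElementary C g) :
    M.IsElementary C fun s x => g s (f s x) :=
  fun Γ φ e => (hg Γ φ fun s x => f s (e s x)).trans (hf Γ φ e)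

theorem Str.SameTypeOver.map {N C : L.Str} {g : ∀ s, N.carrier s → C.carrier s}
    (hg : N.IsElementary C g) {P V : L.Srt → Type u} {p : N.Tuple P} {a b : N.Tuple V}
    (h : N.SameTypeOver p a b) :
    C.SameTypeOver (fun s x => g s (p s x)) (fun s x => g s (a s x)) fun s x => g s (b s x) := by
  intro Γ φ σ
  have key : ∀ c : N.Tuple V,
      φ.Realize C (fun s x => Sum.elim (fun x => g s (c s x)) (fun x => g s (p s x)) (σ s x)) ↔
      φ.Realize N (fun s x => Sum.elim (c s) (p s) (σ s x)) := by
    intro c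
    rw [← hg]
    refine iff_of_eq (congrArg _ ?_)
    funext s x
    rcases σ s x <;> rfl
  exact (key a).trans ((h Γ φ σ).trans (key b).symm)

end Lang

end ManySorted

/-! ### Ultrapowers over `ℕ` and their saturation -/

namespace ManySorted

open Cardinal Filter

/-- A representative of a germ. -/
noncomputable def germRep {ι α : Type*} {l : Filter ι} (g : l.Germ α) : ι → α := Quotient.out g

@[simp] theorem coe_germRep {ι α : Type*} {l : Filter ι} (g : l.Germ α) :
    ((germRep g : ι → α) : l.Germ α) = g := Quotient.out_eq g

theorem germRep_coe {ι α : Type*} {l : Filter ι} (f : ι → α) :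
    germRep (f : l.Germ α) =ᶠ[l] f := Germ.coe_eq.1 (coe_germRep _)

namespace Var

variable {S : Type u}

theorem eventually_forall {ι : Type*} {l : Filter ι} {Γ : List S} {p : ∀ s, Var Γ s → ι → Prop}
    (h : ∀ s x, ∀ᶠ i in l, p s x i) : ∀ᶠ i in l, ∀ s x, p s x i := by
  have := (eventually_all (ι := Σ s, Var Γ s) (p := fun y i => p y.1 y.2 i)).2 fun y => h y.1 y.2
  filter_upwards [this] with i hi s x using hi ⟨s, x⟩

instance countable_tuple (Γ : List S) (F : S → Type*) [∀ s, Countable (F s)] :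
    Countable (∀ s, Var Γ s → F s) :=
  (Equiv.piCurry (β := fun s => Var Γ s) fun s _ => F s).symm.injective.countable

end Var

namespace Lang

variable {L : Lang.{u}}

/-- The ultrapower of `M` over a nonprincipal ultrafilter on `ℕ`. -/
noncomputable def Str.ultrapower (M : L.Str) : L.Str where
  carrier s := (hyperfilter ℕ : Filter ℕ).Germ (M.carrier s)
  nonempty s := ⟨((fun _ => (M.nonempty s).some : ℕ → M.carrier s) : Germ _ _)⟩
  funMap f e := ((fun i => M.funMap f fun t x => germRep (e t x) i : ℕ → M.carrier _) : Germ _ _)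
  relMap R e := ∀ᶠ i in (hyperfilter ℕ : Filter ℕ), M.relMap R fun t x => germRep (e t x) i

/-- The tuple of germs of a tuple of sequences. -/
noncomputable def Str.germs (M : L.Str) {V : L.Srt → Type*} (r : ∀ s, V s → ℕ → M.carrier s) :
    M.ultrapower.Tuple V :=
  fun s x => ((r s x : ℕ → M.carrier s) : (hyperfilter ℕ : Filter ℕ).Germ (M.carrier s))

theorem Str.germs_germRep (M : L.Str) {V : L.Srt → Type*} (e : M.ultrapower.Tuple V) :
    M.germs (fun s x => germRep (e s x)) = e := by
  funext s x
  exact coe_germRep _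

/-- The diagonal embedding. -/
noncomputable def Str.diag (M : L.Str) (s : L.Srt) (a : M.carrier s) : M.ultrapower.carrier s :=
  ((fun _ => a : ℕ → M.carrier s) : (hyperfilter ℕ : Filter ℕ).Germ (M.carrier s))

theorem Str.eventually_germRep_germs (M : L.Str) {Γ : List L.Srt}
    (r : ∀ s, Var Γ s → ℕ → M.carrier s) :
    ∀ᶠ i in (hyperfilter ℕ : Filter ℕ),
      (fun s x => germRep (M.germs r s x) i : M.Tuple (Var Γ)) = fun s x => r s x i := by
  filter_upwards [Var.eventually_forall (p := fun s x i => germRep (M.germs r s x) i = r s x i)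
    fun s x => show _ =ᶠ[_] r s x from
      germRep_coe (l := (hyperfilter ℕ : Filter ℕ)) (r s x)]
    with i hi
  funext s x
  exact hi s x

theorem Str.ultrapower_funMap (M : L.Str) {ar : List L.Srt} {s : L.Srt} (f : L.Fun ar s)
    (r : ∀ s, Var ar s → ℕ → M.carrier s) :
    M.ultrapower.funMap f (M.germs r) =
      ((fun i => M.funMap f fun t x => r t x i : ℕ → M.carrier s) : Germ _ _) := by
  refine Germ.coe_eq.2 ?_
  filter_upwards [M.eventually_germRep_germs r] with i hi
  rw [hi]

theorem Str.ultrapower_relMap (M : L.Str) {ar : List L.Srt} (R : L.Rel ar)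
    (r : ∀ s, Var ar s → ℕ → M.carrier s) :
    M.ultrapower.relMap R (M.germs r) ↔
      ∀ᶠ i in (hyperfilter ℕ : Filter ℕ), M.relMap R fun t x => r t x i := by
  refine eventually_congr ?_
  filter_upwards [M.eventually_germRep_germs r] with i hi
  rw [hi]

theorem Str.cons_germs (M : L.Str) {Γ : List L.Srt} {s : L.Srt} (a : ℕ → M.carrier s)
    (r : ∀ s, Var Γ s → ℕ → M.carrier s) :
    M.ultrapower.cons (a : (hyperfilter ℕ : Filter ℕ).Germ (M.carrier s)) (M.germs r) =
      M.germs (fun t (x : Var (s :: Γ) t) i => M.cons (a i) (fun t x => r t x i) t x) := by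
  funext t x
  cases x <;> rfl

theorem Term.realize_germs (M : L.Str) {Γ : List L.Srt} (r : ∀ s, Var Γ s → ℕ → M.carrier s) :
    ∀ {s : L.Srt} (t : L.Term Γ s), t.realize M.ultrapower (M.germs r) =
      ((fun i => t.realize M fun s x => r s x i : ℕ → M.carrier s) : Germ _ _)
  | _, .var x => rfl
  | _, .app f ts => by
    rw [realize]
    have : (fun t x => (ts t x).realize M.ultrapower (M.germs r)) =
        M.germs fun t x i => (ts t x).realize M fun s x => r s x i := by
      funext t x
      exact realize_germs M r (ts t x)
    rw [this, Str.ultrapower_funMap]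
    rfl

/-- Łoś's theorem. -/
theorem Formula.realize_germs (M : L.Str) : ∀ {Γ : List L.Srt} (φ : L.Formula Γ)
    (r : ∀ s, Var Γ s → ℕ → M.carrier s), φ.Realize M.ultrapower (M.germs r) ↔
      ∀ᶠ i in (hyperfilter ℕ : Filter ℕ), φ.Realize M fun s x => r s x i
  | _, .falsum, r => by simp [Realize, NeBot.ne]
  | _, .eq t₁ t₂, r => by
    simp only [Realize, Term.realize_germs]
    exact Germ.coe_eq
  | _, .rel R ts, r => by
    simp only [Realize, Term.realize_germs]
    exact M.ultrapower_relMap R fun t x i => (ts t x).realize M fun s x => r s x i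
  | _, .imp φ ψ, r => by
    simp only [Realize, realize_germs M φ r, realize_germs M ψ r]
    exact Ultrafilter.eventually_imp.symm
  | _, .all s φ, r => by
    simp only [Realize]
    constructor
    · intro H
      by_contra hc
      rw [← Ultrafilter.eventually_not] at hc
      simp only [not_forall] at hc
      have : ∃ a : ℕ → M.carrier s, ∀ i, (∃ b, ¬ φ.Realize M (M.cons b fun s x => r s x i)) →
          ¬ φ.Realize M (M.cons (a i) fun s x => r s x i) := by
        refine ⟨fun i => open Classical in if h : ∃ b, ¬ φ.Realize M (M.cons b fun s x => r s x i)
          then h.choose else (M.nonempty s).some, fun i h => ?_⟩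
        simp only [dif_pos h]
        exact h.choose_spec
      obtain ⟨a, ha⟩ := this
      have h1 := H (a : (hyperfilter ℕ : Filter ℕ).Germ (M.carrier s))
      rw [Str.cons_germs, realize_germs M φ] at h1
      obtain ⟨i, hi, hi'⟩ := (h1.and hc).exists
      exact ha i hi' hi
    · intro H a
      obtain ⟨a, rfl⟩ : ∃ b : ℕ → M.carrier s,
        (b : (hyperfilter ℕ : Filter ℕ).Germ (M.carrier s)) = a := ⟨_, coe_germRep _⟩
      rw [Str.cons_germs, realize_germs M φ]
      filter_upwards [H] with i hi using hi (a i)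

theorem Str.diag_isElementary (M : L.Str) : M.IsElementary M.ultrapower M.diag := by
  intro Γ φ e
  exact (φ.realize_germs M fun s x _ => e s x).trans (by simp)

theorem Str.IsElementary.isModel_iff {M C : L.Str} {f : ∀ s, M.carrier s → C.carrier s}
    (h : M.IsElementary C f) (T : L.Theory) : C.IsModel T ↔ M.IsModel T := by
  refine forall₂_congr fun φ _ => ?_
  rw [← h]
  exact iff_of_eq (congrArg _ (by funext s x; nomatch x))

/-! ### Countable relational languages -/

theorem Term.countable [∀ ar s, IsEmpty (L.Fun ar s)] (Γ : List L.Srt) (s : L.Srt) :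
    Countable (L.Term Γ s) := by
  refine Function.Surjective.countable (f := Term.var (L := L) (Γ := Γ) (s := s)) ?_
  rintro (x | ⟨f, _⟩)
  · exact ⟨x, rfl⟩
  · exact isEmptyElim f

/-- The nesting depth of a formula. -/
def Formula.depth : ∀ {Γ : List L.Srt}, L.Formula Γ → ℕ
  | _, .imp φ ψ => max φ.depth ψ.depth + 1
  | _, .all _ φ => φ.depth + 1
  | _, _ => 0

/-- The induction is on a bound for the depth and covers all contexts at once, because a quantifier
enlarges the context. -/
theorem Formula.countable [∀ ar s, IsEmpty (L.Fun ar s)] [Countable L.Srt]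
    [∀ ar, Countable (L.Rel ar)] (Γ : List L.Srt) : Countable (L.Formula Γ) := by
  have := Term.countable (L := L)
  suffices H : ∀ n Γ, {φ : L.Formula Γ | φ.depth < n}.Countable by
    rw [← Set.countable_univ_iff]
    refine (Set.countable_iUnion fun n => H n Γ).mono fun φ _ => ?_
    exact Set.mem_iUnion.2 ⟨φ.depth + 1, Nat.lt_succ_self _⟩
  intro n
  induction n with
  | zero => simp
  | succ n ih =>
    intro Γ
    refine (((Set.countable_singleton (Formula.falsum : L.Formula Γ)).union
      (Set.countable_range fun y : Σ s, L.Term Γ s × L.Term Γ s => Formula.eq y.2.1 y.2.2)).union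
      ((Set.countable_range fun y : Σ ar, L.Rel ar × (∀ t, Var ar t → L.Term Γ t) =>
        Formula.rel y.2.1 y.2.2).union
      (((ih Γ).image2 (ih Γ) Formula.imp).union
      (Set.countable_iUnion fun s => (ih (s :: Γ)).image (Formula.all s))))).mono ?_
    intro φ hφ
    cases φ with
    | falsum => exact .inl (.inl rfl)
    | eq t₁ t₂ => exact .inl (.inr ⟨⟨_, t₁, t₂⟩, rfl⟩)
    | rel R ts => exact .inr (.inl ⟨⟨_, R, ts⟩, rfl⟩)
    | imp φ ψ =>
      simp only [depth, Set.mem_ofPred_eq] at hφ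
      refine .inr (.inr (.inl ⟨φ, ?_, ψ, ?_, rfl⟩)) <;> simp only [Set.mem_ofPred_eq] <;> omega
    | all s φ =>
      simp only [depth, Set.mem_ofPred_eq] at hφ
      refine .inr (.inr (.inr (Set.mem_iUnion.2 ⟨s, φ, ?_, rfl⟩)))
      simp only [Set.mem_ofPred_eq]
      omega

/-- Ultrapowers over `ℕ` are `ℵ₁`-saturated in a countable language. -/
theorem Str.ultrapower_isSaturated [Countable L.Srt] [∀ Γ, Countable (L.Formula Γ)] (M : L.Str) :
    M.ultrapower.IsSaturated (ℵ₁ : Cardinal.{u}) := by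
  intro A hA s p hp
  have hA' : Countable (Σ s, A s) := by
    rw [← Cardinal.mk_le_aleph0_iff]
    rwa [← Cardinal.succ_aleph0, Order.lt_succ_iff] at hA
  have : ∀ s, Countable (A s) := fun s =>
    Function.Injective.countable (f := fun a => (⟨s, a⟩ : Σ s, A s)) fun _ _ h => by simpa using h
  have hcount : p.Countable := Set.to_countable p
  obtain rfl | hne := p.eq_empty_or_nonempty
  · exact ⟨(M.ultrapower.nonempty s).some, by simp⟩
  obtain ⟨ψ, hψ⟩ := hcount.exists_eq_range hne
  let r : ∀ j t, Var (ψ j).1 t → ℕ → M.carrier t := fun j t x => germRep ((ψ j).2.2 t x).1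
  have hr : ∀ j, (fun t x => ((ψ j).2.2 t x).1 : M.ultrapower.Tuple (Var (ψ j).1)) =
      M.germs (r j) := fun j => (M.germs_germRep _).symm
  let P : ℕ → ℕ → M.carrier s → Prop := fun j i a =>
    (ψ j).2.1.Realize M (M.cons a fun t x => r j t x i)
  have hP : ∀ (j : ℕ) (a : ℕ → M.carrier s),
      (ψ j).2.1.Realize M.ultrapower (M.ultrapower.cons
        (a : (hyperfilter ℕ : Filter ℕ).Germ (M.carrier s)) fun t x => ((ψ j).2.2 t x).1) ↔
      ∀ᶠ i in (hyperfilter ℕ : Filter ℕ), P j i (a i) := by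
    intro j a
    rw [hr, Str.cons_germs, Formula.realize_germs]
  have hfin : ∀ n : ℕ, ∀ᶠ i in (hyperfilter ℕ : Filter ℕ), ∃ a, ∀ j < n, P j i a := by
    intro n
    classical
    obtain ⟨a, ha⟩ := hp ((Finset.range n).image ψ) (by
      intro x hx
      obtain ⟨j, _, rfl⟩ := Finset.mem_image.1 (Finset.mem_coe.1 hx)
      exact hψ ▸ Set.mem_range_self j)
    obtain ⟨a, rfl⟩ : ∃ b : ℕ → M.carrier s,
      (b : (hyperfilter ℕ : Filter ℕ).Germ (M.carrier s)) = a := ⟨_, coe_germRep _⟩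
    have h1 : ∀ j ∈ Finset.range n, ∀ᶠ i in (hyperfilter ℕ : Filter ℕ), P j i (a i) :=
      fun j hj => (hP j a).1 (ha _ (Finset.mem_image_of_mem ψ hj))
    filter_upwards [(Filter.eventually_all_finset _).2 h1] with i hi
    exact ⟨a i, fun j hj => hi j (Finset.mem_range.2 hj)⟩
  classical
  -- Diagonal choice: in coordinate `i`, realize as many of the first formulas as possible, but at
  -- most `i`. Each fixed `j` is among them for almost all `i`, since the ultrafilter is
  -- nonprincipal.
  let N : ℕ → ℕ := fun i => Nat.findGreatest (fun n => ∃ a, ∀ j < n, P j i a) i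
  have hN : ∀ i, ∃ a, ∀ j < N i, P j i a := fun i =>
    Nat.findGreatest_spec (P := fun n => ∃ a, ∀ j < n, P j i a) (Nat.zero_le i)
      ⟨(M.nonempty s).some, by simp⟩
  choose a ha using hN
  refine ⟨(a : (hyperfilter ℕ : Filter ℕ).Germ (M.carrier s)), ?_⟩
  rw [hψ]
  rintro _ ⟨j, rfl⟩
  rw [hP]
  have hlarge : ∀ᶠ i in (hyperfilter ℕ : Filter ℕ), j + 1 ≤ i := 
    Nat.hyperfilter_le_atTop (eventually_ge_atTop (j + 1))
  filter_upwards [hfin (j + 1), hlarge] with i hi hle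
  exact ha i j (Nat.le_findGreatest hle hi)

end Lang

end ManySorted

namespace ManySorted

/-! ### Truncated distances in linear orders -/

/-- `m` and `n` are equal, or both are at least `K`. -/
def TruncEq (K : ℕ) (m n : ℕ∞) : Prop := m = n ∨ ((K : ℕ∞) ≤ m ∧ (K : ℕ∞) ≤ n)

namespace TruncEq

variable {K K' : ℕ} {m n m' n' : ℕ∞}

theorem refl (K : ℕ) (m : ℕ∞) : TruncEq K m m := .inl rfl

theorem symm (h : TruncEq K m n) : TruncEq K n m := h.imp Eq.symm And.symm

theorem mono (hK : K ≤ K') (h : TruncEq K' m n) : TruncEq K m n :=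
  h.imp id fun h => ⟨(Nat.cast_le.2 hK).trans h.1, (Nat.cast_le.2 hK).trans h.2⟩

/-- A sum reaches `K` as soon as one summand does. This additivity is why only distances between
neighbours need attention later. -/
theorem add (h : TruncEq K m n) (h' : TruncEq K m' n') : TruncEq K (m + m') (n + n') := by
  rcases h with rfl | h
  · rcases h' with rfl | h'
    · exact .inl rfl
    · exact .inr ⟨h'.1.trans le_add_self, h'.2.trans le_add_self⟩
  · exact .inr ⟨h.1.trans le_self_add, h.2.trans le_self_add⟩

theorem eq_zero_iff (hK : 0 < K) (h : TruncEq K m n) : m = 0 ↔ n = 0 := by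
  rcases h with rfl | h
  · rfl
  · have hK' : (0 : ℕ∞) < K := by exact_mod_cast hK
    exact iff_of_false (hK'.trans_le h.1).ne' (hK'.trans_le h.2).ne'

end TruncEq

section Dist

variable {Λ : Type u} [LinearOrder Λ]

/-- The number of elements of the half-open interval from `x` to `y`. -/
noncomputable def gapCard (x y : Λ) : ℕ∞ := (Set.Ico x y).encard

theorem gapCard_eq_zero {x y : Λ} : gapCard x y = 0 ↔ y ≤ x := by
  simp [gapCard, Set.Ico_eq_empty_iff]

theorem gapCard_add {x y z : Λ} (h : x ≤ z) (h' : z ≤ y) :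
    gapCard x z + gapCard z y = gapCard x y := by
  rw [gapCard, gapCard, gapCard, ← Set.Ico_union_Ico_eq_Ico h h', Set.encard_union_eq]
  exact Set.disjoint_left.2 fun _ h1 h2 => h1.2.not_ge h2.1

theorem gapCard_mono {x x' y y' : Λ} (h : x' ≤ x) (h' : y ≤ y') : gapCard x y ≤ gapCard x' y' :=
  Set.encard_le_encard (Set.Ico_subset_Ico h h')

theorem gapCard_covBy {x y : Λ} (h : x ⋖ y) : gapCard x y = 1 := by
  rw [gapCard, h.Ico_eq, Set.encard_singleton]

theorem gapCard_eq_top_of_lt [DenselyOrdered Λ] {x y : Λ} (h : x < y) : gapCard x y = ⊤ :=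
  Set.encard_eq_top_iff.2 (Set.Ico_infinite h)

/-- Pairs in `A` have pairwise the same truncated distances. -/
def TruncIso (K : ℕ) (A : Set (Λ × Λ)) : Prop :=
  ∀ p ∈ A, ∀ q ∈ A, TruncEq K (gapCard p.1 q.1) (gapCard p.2 q.2)

/-- Which gaps vanish determines the order, and truncation at a positive bound does not affect
vanishing. -/
theorem TruncIso.le_iff {K : ℕ} (hK : 0 < K) {A : Set (Λ × Λ)} (h : TruncIso K A) {p q : Λ × Λ}
    (hp : p ∈ A) (hq : q ∈ A) : p.1 ≤ q.1 ↔ p.2 ≤ q.2 := by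
  rw [← gapCard_eq_zero, ← gapCard_eq_zero]
  exact (h q hq p hp).eq_zero_iff hK

theorem TruncIso.swap {K : ℕ} {A : Set (Λ × Λ)} (h : TruncIso K A) :
    TruncIso K (Prod.swap ⁻¹' A) :=
  fun p hp q hq => (h p.swap hp q.swap hq).symm

theorem TruncIso.mono {K K' : ℕ} (hK : K ≤ K') {A B : Set (Λ × Λ)} (h : TruncIso K' A)
    (hB : B ⊆ A) : TruncIso K B :=
  fun p hp q hq => (h p (hB hp) q (hB hq)).mono hK

variable (Λ) in
/-- Points dividing an interval can be copied to an interval of the same truncated length. -/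
def Divisible : Prop :=
  ∀ (K : ℕ) (x y x' y' z : Λ), 0 < K → TruncEq (2 * K) (gapCard x y) (gapCard x' y') →
    x ≤ z → z < y → ∃ z', x' ≤ z' ∧ z' < y' ∧ TruncEq K (gapCard x z) (gapCard x' z') ∧
      TruncEq K (gapCard z y) (gapCard z' y')

/-- Only the gap between the two neighbours of `z` in `A` has to be divided, which costs half of the
precision. The gaps from `z` to all other points are sums passing through a neighbour, so
`TruncEq.add` handles them. -/
theorem Divisible.exists_truncIso_insert (hΛ : Divisible Λ) {K : ℕ} (hK : 0 < K)
    {A : Set (Λ × Λ)} (hfin : A.Finite) (hA : TruncIso (2 * K) A) {z : Λ} (h1 : ∃ p ∈ A, p.1 ≤ z)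
    (h2 : ∃ p ∈ A, z < p.1) : ∃ z', TruncIso K (insert (z, z') A) := by
  obtain ⟨x, ⟨hx, hxz⟩, hmax⟩ := Set.exists_max_image {p ∈ A | p.1 ≤ z} Prod.fst
    (hfin.subset fun _ h => h.1) h1
  obtain ⟨y, ⟨hy, hzy⟩, hmin⟩ := Set.exists_min_image {p ∈ A | z < p.1} Prod.fst
    (hfin.subset fun _ h => h.1) h2
  obtain ⟨z', hxz', hzy', hd1, hd2⟩ := hΛ K x.1 y.1 x.2 y.2 z hK (hA x hx y hy) hxz hzy
  have hA' : TruncIso K A := hA.mono (by omega) subset_rfl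
  have key : ∀ p ∈ A, TruncEq K (gapCard p.1 z) (gapCard p.2 z') ∧
      TruncEq K (gapCard z p.1) (gapCard z' p.2) := by
    intro p hp
    rcases le_or_gt p.1 z with h | h
    · have hpx := hmax p ⟨hp, h⟩
      have hpx' := (hA'.le_iff hK hp hx).1 hpx
      rw [gapCard_eq_zero.2 h, gapCard_eq_zero.2 (hpx'.trans hxz'), ← gapCard_add hpx hxz,
        ← gapCard_add hpx' hxz']
      exact ⟨(hA' p hp x hx).add hd1, .refl _ _⟩
    · have hpy := hmin p ⟨hp, h⟩
      have hpy' := (hA'.le_iff hK hy hp).1 hpy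
      rw [gapCard_eq_zero.2 h.le, gapCard_eq_zero.2 (hzy'.le.trans hpy'),
        ← gapCard_add hzy.le hpy, ← gapCard_add hzy'.le hpy']
      exact ⟨.refl _ _, hd2.add (hA' y hy p hp)⟩
  refine ⟨z', ?_⟩
  rintro p (rfl | hp) q (rfl | hq)
  · exact .inl (by rw [gapCard_eq_zero.2 le_rfl, gapCard_eq_zero.2 le_rfl])
  · exact (key q hq).2
  · exact (key p hp).1
  · exact hA' p hp q hq

/-- All gaps are `0` or `⊤`, so it only matters whether `z` is the left end or an interior point. -/
theorem divisible_of_dense [DenselyOrdered Λ] : Divisible Λ := by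
  intro K x y x' y' z hK h hxz hzy
  have hxy' : x' < y' := by
    rw [← not_le, ← gapCard_eq_zero, ← h.eq_zero_iff (by omega), gapCard_eq_zero, not_le]
    exact hxz.trans_lt hzy
  rcases hxz.eq_or_lt with rfl | hlt
  · refine ⟨x', le_rfl, hxy', .inl ?_, h.mono (by omega)⟩
    rw [gapCard_eq_zero.2 le_rfl, gapCard_eq_zero.2 le_rfl]
  · obtain ⟨z', h1, h2⟩ := exists_between hxy'
    refine ⟨z', h1.le, h2, .inl ?_, .inl ?_⟩
    · rw [gapCard_eq_top_of_lt hlt, gapCard_eq_top_of_lt h1]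
    · rw [gapCard_eq_top_of_lt hzy, gapCard_eq_top_of_lt h2]

section Discrete

theorem exists_gapCard_left_eq (hs : ∀ x : Λ, ∃ y, x ⋖ y) {x y : Λ} (hxy : x ≤ y) (m : ℕ)
    (hm : (m : ℕ∞) ≤ gapCard x y) : ∃ z, x ≤ z ∧ z ≤ y ∧ gapCard x z = m := by
  induction m with
  | zero => exact ⟨x, le_rfl, hxy, by simp [gapCard_eq_zero]⟩
  | succ m ih =>
    obtain ⟨z, hxz, hzy, hz⟩ := ih (le_trans (by exact_mod_cast Nat.le_succ m) hm)
    have hlt : z < y := hzy.lt_of_ne fun h => by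
      rw [← h, hz] at hm
      exact absurd (Nat.cast_le.1 hm) (by omega)
    obtain ⟨w, hw⟩ := hs z
    refine ⟨w, hxz.trans hw.le, hw.ge_of_gt hlt, ?_⟩
    rw [← gapCard_add hxz hw.le, hz, gapCard_covBy hw]
    rfl

theorem exists_gapCard_right_eq (hp : ∀ y : Λ, ∃ x, x ⋖ y) {x y : Λ} (hxy : x ≤ y) (m : ℕ)
    (hm : (m : ℕ∞) ≤ gapCard x y) : ∃ z, x ≤ z ∧ z ≤ y ∧ gapCard z y = m := by
  induction m with
  | zero => exact ⟨y, hxy, le_rfl, by simp [gapCard_eq_zero]⟩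
  | succ m ih =>
    obtain ⟨z, hxz, hzy, hz⟩ := ih (le_trans (by exact_mod_cast Nat.le_succ m) hm)
    have hlt : x < z := hxz.lt_of_ne fun h => by
      rw [h, hz] at hm
      exact absurd (Nat.cast_le.1 hm) (by omega)
    obtain ⟨w, hw⟩ := hp z
    refine ⟨w, hw.le_of_lt hlt, hw.le.trans hzy, ?_⟩
    rw [← gapCard_add hw.le hzy, hz, gapCard_covBy hw, add_comm]
    rfl

/-- If both parts have length at least `K`, stepping `K` places from the left end of the target
leaves at least `K`. Otherwise a part of finite length `m` is copied exactly, counting from its own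
end. The rest then agrees exactly if the total gaps are equal; if they are only known to be at least
`2 * K`, then `m < K` and both rests are at least `K`. -/
theorem divisible_of_discrete (hs : ∀ x : Λ, ∃ y, x ⋖ y) (hp : ∀ y : Λ, ∃ x, x ⋖ y) :
    Divisible Λ := by
  intro K x y x' y' z hK h hxz hzy
  have hxy' : x' < y' := by
    rw [← not_le, ← gapCard_eq_zero, ← h.eq_zero_iff (by omega), gapCard_eq_zero, not_le]
    exact hxz.trans_lt hzy
  have hD := gapCard_add hxz hzy.le
  have hd2 : gapCard z y ≠ 0 := fun h => (gapCard_eq_zero.1 h).not_gt hzy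
  have hlt : ∀ {z'}, TruncEq K (gapCard z y) (gapCard z' y') → z' < y' := fun h => by
    rwa [← not_le, ← gapCard_eq_zero, ← h.eq_zero_iff hK]
  have h2K : ((2 * K : ℕ) : ℕ∞) = K + K := by push_cast; ring
  -- both halves can be made at least `K`
  have big : (K : ℕ∞) ≤ gapCard x z → (K : ℕ∞) ≤ gapCard z y →
      ((2 * K : ℕ) : ℕ∞) ≤ gapCard x' y' → ∃ z', x' ≤ z' ∧ z' < y' ∧
        TruncEq K (gapCard x z) (gapCard x' z') ∧ TruncEq K (gapCard z y) (gapCard z' y') := by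
    intro h1 h2 h3
    obtain ⟨z', hz1, hz2, hz⟩ := exists_gapCard_left_eq hs hxy'.le K
      (le_trans (by rw [h2K]; exact le_self_add) h3)
    have h4 : (K : ℕ∞) ≤ gapCard z' y' := by
      rw [← gapCard_add hz1 hz2, hz, h2K] at h3
      exact (ENat.add_le_add_iff_left (ENat.natCast_ne_top K)).1 h3
    exact ⟨z', hz1, hlt (.inr ⟨h2, h4⟩), .inr ⟨h1, hz.ge⟩, .inr ⟨h2, h4⟩⟩
  -- a finite left half
  have left : ∀ m : ℕ, gapCard x z = m → (gapCard x y = gapCard x' y' ∨ m < K) →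
      ∃ z', x' ≤ z' ∧ z' < y' ∧
        TruncEq K (gapCard x z) (gapCard x' z') ∧ TruncEq K (gapCard z y) (gapCard z' y') := by
    intro m hm hor
    have hle : (m : ℕ∞) ≤ gapCard x' y' := by
      rcases h with h | h
      · rw [← h, ← hD, hm]
        exact le_self_add
      · rcases hor with hor | hor
        · rw [← hor, ← hD, hm]
          exact le_self_add
        · exact le_trans (Nat.cast_le.2 (by omega)) h.2
    obtain ⟨z', hz1, hz2, hz⟩ := exists_gapCard_left_eq hs hxy'.le m hle
    have hD' := gapCard_add hz1 hz2
    rw [hz] at hD'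
    rw [hm] at hD
    have : TruncEq K (gapCard z y) (gapCard z' y') := by
      by_cases he : gapCard x y = gapCard x' y'
      · rw [← hD, ← hD'] at he
        exact .inl (ENat.add_right_injective_of_ne_top (ENat.natCast_ne_top m) he)
      · have hmK : m ≤ K := (hor.resolve_left he).le
        have aux : ∀ d : ℕ∞, ((2 * K : ℕ) : ℕ∞) ≤ m + d → (K : ℕ∞) ≤ d := fun d hd => by
          have : (K : ℕ∞) + K ≤ K + d := by
            rw [← h2K]
            exact hd.trans (by gcongr)
          exact (ENat.add_le_add_iff_left (ENat.natCast_ne_top K)).1 this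
        obtain ⟨ha, hb⟩ := h.resolve_left he
        exact .inr ⟨aux _ (hD ▸ ha), aux _ (hD' ▸ hb)⟩
    exact ⟨z', hz1, hlt this, .inl (hm.trans hz.symm), this⟩
  have right : ∀ m : ℕ, gapCard z y = m → (gapCard x y = gapCard x' y' ∨ m < K) →
      ∃ z', x' ≤ z' ∧ z' < y' ∧
        TruncEq K (gapCard x z) (gapCard x' z') ∧ TruncEq K (gapCard z y) (gapCard z' y') := by
    intro m hm hor
    have hle : (m : ℕ∞) ≤ gapCard x' y' := by
      rcases h with h | h
      · rw [← h, ← hD, hm]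
        exact le_add_self
      · rcases hor with hor | hor
        · rw [← hor, ← hD, hm]
          exact le_add_self
        · exact le_trans (Nat.cast_le.2 (by omega)) h.2
    obtain ⟨z', hz1, hz2, hz⟩ := exists_gapCard_right_eq hp hxy'.le m hle
    have hD' := gapCard_add hz1 hz2
    rw [hz, add_comm] at hD'
    rw [hm, add_comm] at hD
    have : TruncEq K (gapCard x z) (gapCard x' z') := by
      by_cases he : gapCard x y = gapCard x' y'
      · rw [← hD, ← hD'] at he
        exact .inl (ENat.add_right_injective_of_ne_top (ENat.natCast_ne_top m) he)
      · have hmK : m ≤ K := (hor.resolve_left he).le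
        have aux : ∀ d : ℕ∞, ((2 * K : ℕ) : ℕ∞) ≤ m + d → (K : ℕ∞) ≤ d := fun d hd => by
          have : (K : ℕ∞) + K ≤ K + d := by
            rw [← h2K]
            exact hd.trans (by gcongr)
          exact (ENat.add_le_add_iff_left (ENat.natCast_ne_top K)).1 this
        obtain ⟨ha, hb⟩ := h.resolve_left he
        exact .inr ⟨aux _ (hD ▸ ha), aux _ (hD' ▸ hb)⟩
    have h2 : TruncEq K (gapCard z y) (gapCard z' y') := .inl (hm.trans hz.symm)
    exact ⟨z', hz1, hlt h2, this, h2⟩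
  have fin_of_lt : ∀ {d : ℕ∞}, d < ⊤ → ∃ m : ℕ, d = m := fun h =>
    ⟨_, (ENat.natCast_toNat h.ne).symm⟩
  rcases h with h | h
  · rcases (le_top (a := gapCard x z)).lt_or_eq with h1 | h1
    · obtain ⟨m, hm⟩ := fin_of_lt h1
      exact left m hm (.inl h)
    rcases (le_top (a := gapCard z y)).lt_or_eq with h2 | h2
    · obtain ⟨m, hm⟩ := fin_of_lt h2
      exact right m hm (.inl h)
    exact big (by simp [h1]) (by simp [h2]) (by simp [← h, ← hD, h1])
  · rcases lt_or_ge (gapCard x z) K with h1 | h1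
    · obtain ⟨m, hm⟩ := fin_of_lt (h1.trans (ENat.natCast_lt_top K))
      exact left m hm (.inr (by rw [hm] at h1; exact_mod_cast h1))
    rcases lt_or_ge (gapCard z y) K with h2 | h2
    · obtain ⟨m, hm⟩ := fin_of_lt (h2.trans (ENat.natCast_lt_top K))
      exact right m hm (.inr (by rw [hm] at h2; exact_mod_cast h2))
    exact big h1 h2 h.2

end Discrete

/-! ### Filling the same cut -/

/-- The points `c₁` and `c₂` of the interval `[u, v)` fill the same cut over a subset `S` which
is finitely dense in the interval with respect to truncated distances. -/
def SameCut (u v c₁ c₂ : Λ) : Prop :=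
  ∃ S ⊆ Set.Ico u v,
    (∀ F ⊆ S, F.Finite → ∀ K : ℕ, ∀ z ∈ Set.Ico u v, ∃ z' ∈ S, ∀ w ∈ insert u (insert v F),
      TruncEq K (gapCard w z) (gapCard w z') ∧ TruncEq K (gapCard z w) (gapCard z' w)) ∧
    ∀ w ∈ insert u (insert v S), gapCard w c₁ = gapCard w c₂ ∧ gapCard c₁ w = gapCard c₂ w

/-- The set is the part of the interval below both points. It is finitely dense because a point
further right is imitated by one just below `min c₁ c₂` and above the given finite set: gaps only
record the order. -/
theorem sameCut_of_dense [DenselyOrdered Λ] {u v c₁ c₂ : Λ} (hu : u < min c₁ c₂)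
    (hv : max c₁ c₂ < v) : SameCut u v c₁ c₂ := by
  have hmv : min c₁ c₂ < v := min_le_max.trans_lt hv
  refine ⟨Set.Ico u (min c₁ c₂), Set.Ico_subset_Ico_right hmv.le, ?_, ?_⟩
  · intro F hF hfin K z hz
    rcases lt_or_ge z (min c₁ c₂) with h | h
    · exact ⟨z, ⟨hz.1, h⟩, fun w _ => ⟨.refl _ _, .refl _ _⟩⟩
    obtain ⟨w₀, hw₀, hmax⟩ := Set.exists_max_image (insert u F) id (hfin.insert u)
      ⟨u, Set.mem_insert _ _⟩
    have hsub : insert u F ⊆ Set.Ico u (min c₁ c₂) := Set.insert_subset ⟨le_rfl, hu⟩ hF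
    obtain ⟨z', h1, h2⟩ := exists_between (hsub hw₀).2
    refine ⟨z', ⟨(hmax u (Set.mem_insert _ _)).trans h1.le, h2⟩, ?_⟩
    have left : ∀ w ∈ insert u F, TruncEq K (gapCard w z) (gapCard w z') ∧
        TruncEq K (gapCard z w) (gapCard z' w) := by
      intro w hw
      have hwz : w < z := (hsub hw).2.trans_le h
      have hwz' : w < z' := (hmax w hw).trans_lt h1
      rw [gapCard_eq_top_of_lt hwz, gapCard_eq_top_of_lt hwz', gapCard_eq_zero.2 hwz.le,
        gapCard_eq_zero.2 hwz'.le]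
      exact ⟨.refl _ _, .refl _ _⟩
    intro w hw
    rw [Set.insert_comm] at hw
    rcases hw with rfl | hw
    · have hzv := h2.trans hmv
      rw [gapCard_eq_top_of_lt hz.2, gapCard_eq_top_of_lt hzv, gapCard_eq_zero.2 hz.2.le,
        gapCard_eq_zero.2 hzv.le]
      exact ⟨.refl _ _, .refl _ _⟩
    · exact left w hw
  · intro w hw
    have hor : (w < c₁ ∧ w < c₂) ∨ (c₁ < w ∧ c₂ < w) := by
      rcases hw with rfl | rfl | hw
      · exact .inl (lt_min_iff.1 hu)
      · exact .inr (max_lt_iff.1 hv)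
      · exact .inl (lt_min_iff.1 hw.2)
    rcases hor with h | h
    · rw [gapCard_eq_top_of_lt h.1, gapCard_eq_top_of_lt h.2, gapCard_eq_zero.2 h.1.le,
        gapCard_eq_zero.2 h.2.le]
      exact ⟨rfl, rfl⟩
    · rw [gapCard_eq_top_of_lt h.1, gapCard_eq_top_of_lt h.2, gapCard_eq_zero.2 h.1.le,
        gapCard_eq_zero.2 h.2.le]
      exact ⟨rfl, rfl⟩

theorem gapCard_eq_top_of_left {u w x : Λ} (huw : u ≤ w) (hw : gapCard u w < ⊤)
    (hx : gapCard u x = ⊤) : w < x ∧ gapCard w x = ⊤ := by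
  have hwx : w < x := lt_of_not_ge fun h =>
    (hw.trans_le (hx ▸ gapCard_mono le_rfl h)).false
  refine ⟨hwx, ?_⟩
  rw [← gapCard_add huw hwx.le] at hx
  exact (WithTop.add_eq_top.1 hx).resolve_left hw.ne

theorem gapCard_eq_top_of_right {v w x : Λ} (hwv : w ≤ v) (hw : gapCard w v < ⊤)
    (hx : gapCard x v = ⊤) : x < w ∧ gapCard x w = ⊤ := by
  have hwx : x < w := lt_of_not_ge fun h =>
    (hw.trans_le (hx ▸ gapCard_mono h le_rfl)).false
  refine ⟨hwx, ?_⟩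
  rw [← gapCard_add hwx.le hwv] at hx
  exact (WithTop.add_eq_top.1 hx).resolve_right hw.ne

/-- The set consists of the points at finite distance from an end of the interval. Both `c₁` and
`c₂` are infinitely far from all of them, and a point far from both ends is imitated by one at a
large finite distance from `u`. -/
theorem sameCut_of_discrete (hs : ∀ x : Λ, ∃ y, x ⋖ y) {u v c₁ c₂ : Λ}
    (h1 : gapCard u c₁ = ⊤) (h2 : gapCard u c₂ = ⊤) (h3 : gapCard c₁ v = ⊤)
    (h4 : gapCard c₂ v = ⊤) : SameCut u v c₁ c₂ := by
  have huv : u < v := by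
    have hlt : ∀ {x y : Λ}, gapCard x y = ⊤ → x < y := fun h => lt_of_not_ge fun h' => by
      rw [gapCard_eq_zero.2 h'] at h
      exact ENat.top_ne_zero h.symm
    exact (hlt h1).trans (hlt h3)
  refine ⟨{x ∈ Set.Ico u v | gapCard u x < ⊤ ∨ gapCard x v < ⊤}, fun _ h => h.1, ?_, ?_⟩
  · intro F hF hfin K z hz
    by_cases hzS : gapCard u z < ⊤ ∨ gapCard z v < ⊤
    · exact ⟨z, ⟨hz, hzS⟩, fun w _ => ⟨.refl _ _, .refl _ _⟩⟩
    simp only [not_or, not_lt_top_iff] at hzS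
    obtain ⟨B, hB⟩ := (hfin.image fun w => (gapCard u w).toNat).bddAbove
    -- `B` bounds the finite distances from `u` to points of `F` (`toNat` makes the infinite ones
    -- `0`). So `z'` is at least `K` beyond each of these points, while still at finite distance
    -- from `u`.
    obtain ⟨z', hz1, hz2, hz'⟩ := exists_gapCard_left_eq hs hz.1 (B + K) (by simp [hzS.1])
    have hz'z : z' < z := hz2.lt_of_ne fun h => by
      rw [h, hzS.1] at hz'
      exact ENat.natCast_ne_top _ hz'.symm
    refine ⟨z', ⟨⟨hz1, hz'z.trans hz.2⟩, .inl (hz' ▸ ENat.natCast_lt_top _)⟩, ?_⟩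
    have left : ∀ w, u ≤ w → gapCard u w ≤ B → TruncEq K (gapCard w z) (gapCard w z') ∧
        TruncEq K (gapCard z w) (gapCard z' w) := by
      intro w huw hw
      have ⟨hwz, htop⟩ := gapCard_eq_top_of_left huw (hw.trans_lt (ENat.natCast_lt_top B)) hzS.1
      have hwz' : w ≤ z' := by
        by_contra! hlt
        have h5 := hw
        rw [← gapCard_add hz1 hlt.le, hz'] at h5
        have h6 : gapCard z' w ≠ 0 := fun h => (gapCard_eq_zero.1 h).not_gt hlt
        have h7 : ((B + K : ℕ) : ℕ∞) + 1 ≤ B := le_trans (by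
          gcongr
          exact Order.one_le_iff_pos.2 (pos_iff_ne_zero.2 h6)) h5
        have : B + K + 1 ≤ B := by exact_mod_cast h7
        omega
      have hK : (K : ℕ∞) ≤ gapCard w z' := by
        have h5 := gapCard_add huw hwz'
        rw [hz'] at h5
        have h6 : (B : ℕ∞) + K ≤ B + gapCard w z' := by
          calc (B : ℕ∞) + K = gapCard u w + gapCard w z' := by rw [h5]; push_cast; rfl
            _ ≤ _ := by gcongr
        exact (ENat.add_le_add_iff_left (ENat.natCast_ne_top B)).1 h6
      refine ⟨.inr ⟨by simp [htop], hK⟩, .inl ?_⟩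
      rw [gapCard_eq_zero.2 hwz.le, gapCard_eq_zero.2 hwz']
    have right : ∀ w, w ≤ v → gapCard w v < ⊤ → TruncEq K (gapCard w z) (gapCard w z') ∧
        TruncEq K (gapCard z w) (gapCard z' w) := by
      intro w hwv hw
      have ⟨hzw, htop⟩ := gapCard_eq_top_of_right hwv hw hzS.2
      have htop' : gapCard z' w = ⊤ := top_le_iff.1 (htop ▸ gapCard_mono hz'z.le le_rfl)
      rw [gapCard_eq_zero.2 hzw.le, gapCard_eq_zero.2 (hz'z.trans hzw).le, htop, htop']
      exact ⟨.refl _ _, .refl _ _⟩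
    rintro w (rfl | rfl | hw)
    · exact left w le_rfl (by simp [gapCard_eq_zero.2 le_rfl])
    · exact right w le_rfl (by simp [gapCard_eq_zero.2 le_rfl])
    · have hwS := hF hw
      rcases hwS.2 with h | h
      · refine left w hwS.1.1 ?_
        rw [← ENat.natCast_toNat h.ne]
        exact Nat.cast_le.2 (hB ⟨w, hw, rfl⟩)
      · exact right w hwS.1.2.le h
  · have left : ∀ w, u ≤ w → gapCard u w < ⊤ →
        gapCard w c₁ = gapCard w c₂ ∧ gapCard c₁ w = gapCard c₂ w := by
      intro w huw hw
      have ⟨a1, a2⟩ := gapCard_eq_top_of_left huw hw h1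
      have ⟨b1, b2⟩ := gapCard_eq_top_of_left huw hw h2
      rw [a2, b2, gapCard_eq_zero.2 a1.le, gapCard_eq_zero.2 b1.le]
      exact ⟨rfl, rfl⟩
    have right : ∀ w, w ≤ v → gapCard w v < ⊤ →
        gapCard w c₁ = gapCard w c₂ ∧ gapCard c₁ w = gapCard c₂ w := by
      intro w hwv hw
      have ⟨a1, a2⟩ := gapCard_eq_top_of_right hwv hw h3
      have ⟨b1, b2⟩ := gapCard_eq_top_of_right hwv hw h4
      rw [a2, b2, gapCard_eq_zero.2 a1.le, gapCard_eq_zero.2 b1.le]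
      exact ⟨rfl, rfl⟩
    rintro w (rfl | rfl | hw)
    · exact left w le_rfl (by simp [gapCard_eq_zero.2 le_rfl])
    · exact right w le_rfl (by simp [gapCard_eq_zero.2 le_rfl])
    · rcases hw.2 with h | h
      · exact left w hw.1.1 h
      · exact right w hw.1.2.le h

end Dist

end ManySorted

/-! ### The language of circles -/

namespace ManySorted

open Cardinal Filter

/-- The pair `a, b` as a tuple indexed by a context of length two. -/
def Var.pair {S : Type u} {F : S → Type*} {s : S} (a b : F s) : ∀ t, Var [s, s] t → F t
  | _, .zero => a
  | _, .succ .zero => b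

theorem Var.pair_eta {S : Type u} {F : S → Type*} {s : S} (e : ∀ t, Var [s, s] t → F t) :
    Var.pair (e s .zero) (e s (.succ .zero)) = e := by
  funext t x
  match t, x with
  | _, .zero => rfl
  | _, .succ .zero => rfl

theorem Var.map_pair {S : Type u} {F G : S → Type*} (f : ∀ s, F s → G s) {s : S} (a b : F s) :
    (fun t x => f t (Var.pair a b t x)) = Var.pair (f s a) (f s b) := by
  funext t x
  match t, x with
  | _, .zero => rfl
  | _, .succ .zero => rfl

namespace Lang

/-- The only symbol on each sort is a binary relation. -/
inductive CircRel : List (ULift.{u} ℕ) → Type u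
  | arc (n : ULift.{u} ℕ) : CircRel [n, n]

/-- A language with countably many sorts and one binary relation on each sort. -/
def circ : Lang.{u} where
  Srt := ULift.{u} ℕ
  Fun := fun _ _ => PEmpty.{u + 1}
  Rel := CircRel

/-- The binary relation on the sort `n`. -/
def arc (n : circ.{u}.Srt) : circ.{u}.Rel [n, n] := CircRel.arc n

instance (ar : List circ.{u}.Srt) (s : circ.{u}.Srt) : IsEmpty (circ.{u}.Fun ar s) :=
  inferInstanceAs (IsEmpty PEmpty)

instance : Countable circ.{u}.Srt := inferInstanceAs (Countable (ULift ℕ))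

instance : DecidableEq circ.{u}.Srt := inferInstanceAs (DecidableEq (ULift ℕ))

instance (ar : List circ.{u}.Srt) : Countable (circ.{u}.Rel ar) :=
  Function.Surjective.countable (f := fun p : {n : circ.{u}.Srt // ar = [n, n]} =>
    (p.2.symm ▸ arc p.1 : circ.{u}.Rel ar)) fun R => by
    cases R with
    | arc n => exact ⟨⟨n, rfl⟩, rfl⟩

theorem card_circ_add_lt : circ.{u}.card + ℵ₀ < (ℵ₁ : Cardinal.{u}) := by
  rw [← Cardinal.succ_aleph0, Order.lt_succ_iff]
  have h1 : #circ.{u}.Srt ≤ ℵ₀ := mk_le_aleph0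
  have h2 : #(Σ ar : List circ.{u}.Srt, Σ s : circ.{u}.Srt, circ.{u}.Fun ar s) ≤ ℵ₀ :=
    mk_le_aleph0
  have h3 : #(Σ ar : List circ.{u}.Srt, circ.{u}.Rel ar) ≤ ℵ₀ := mk_le_aleph0
  exact add_le_aleph0.2 ⟨add_le_aleph0.2 ⟨add_le_aleph0.2 ⟨h1, h2⟩, h3⟩, le_rfl⟩

/-! ### Charts and back-and-forth -/

/-- Coordinates for the sort `n`: a position in the interval `[u, v)` of a linear order and a
label; the relation holds between points which are less than one turn apart. -/
structure Chart (N : circ.{u}.Str) (n : circ.{u}.Srt) {Λ : Type u} [LinearOrder Λ] (u v : Λ)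
    (Z : Type) [AddCommGroupWithOne Z] where
  pos : N.carrier n → Λ
  label : N.carrier n → Z
  pos_mem : ∀ t, pos t ∈ Set.Ico u v
  ext : ∀ t t', pos t = pos t' → label t = label t' → t = t'
  exists_point : ∀ z ∈ Set.Ico u v, ∀ l, ∃ t, pos t = z ∧ label t = l
  relMap_iff : ∀ t t', N.relMap (arc n) (Var.pair t t') ↔
    (label t' = label t ∧ pos t ≤ pos t') ∨ (label t' = label t + 1 ∧ pos t' < pos t)

namespace Chart

variable {N : circ.{u}.Str} {n : circ.{u}.Srt} {Λ : Type u} [LinearOrder Λ] {u v : Λ}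
  {Z : Type} [AddCommGroupWithOne Z] (χ : Chart N n u v Z)

/-- The pairs of corresponding positions of two tuples, and the two ends of the interval. -/
def pairs {Γ : List circ.{u}.Srt} (e e' : N.Tuple (Var Γ)) : Set (Λ × Λ) :=
  insert (u, u) (insert (v, v) (Set.range fun x => (χ.pos (e n x), χ.pos (e' n x))))

/-- The tuples differ only in the positions of their entries of sort `n`, and have the same
truncated distances there. -/
structure Sim (K : ℕ) {Γ : List circ.{u}.Srt} (e e' : N.Tuple (Var Γ)) : Prop where
  eq_of_ne : ∀ s, s ≠ n → ∀ x, e s x = e' s x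
  label_eq : ∀ x, χ.label (e n x) = χ.label (e' n x)
  truncIso : TruncIso K (χ.pairs e e')

variable {χ}

theorem Sim.symm {K : ℕ} {Γ : List circ.{u}.Srt} {e e' : N.Tuple (Var Γ)} (h : χ.Sim K e e') :
    χ.Sim K e' e where
  eq_of_ne s hs x := (h.eq_of_ne s hs x).symm
  label_eq x := (h.label_eq x).symm
  truncIso := h.truncIso.swap.mono le_rfl (by
    rintro p (rfl | rfl | ⟨x, rfl⟩)
    · exact .inl rfl
    · exact .inr (.inl rfl)
    · exact .inr (.inr ⟨x, rfl⟩))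

theorem Sim.mono {K K' : ℕ} (hK : K ≤ K') {Γ : List circ.{u}.Srt} {e e' : N.Tuple (Var Γ)}
    (h : χ.Sim K' e e') : χ.Sim K e e' :=
  ⟨h.eq_of_ne, h.label_eq, h.truncIso.mono hK subset_rfl⟩

theorem Sim.pos_le_iff {K : ℕ} (hK : 0 < K) {Γ : List circ.{u}.Srt} {e e' : N.Tuple (Var Γ)}
    (h : χ.Sim K e e') (x y : Var Γ n) :
    χ.pos (e n x) ≤ χ.pos (e n y) ↔ χ.pos (e' n x) ≤ χ.pos (e' n y) :=
  h.truncIso.le_iff hK (.inr (.inr ⟨x, rfl⟩)) (.inr (.inr ⟨y, rfl⟩))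

/-- Entries of other sorts are copied unchanged. In sort `n` the position is moved by
`exists_truncIso_insert`; as both ends belong to `pairs`, the new position stays in the interval,
where the chart provides a point with the required label. -/
theorem Sim.forth (hΛ : Divisible Λ) {K : ℕ} (hK : 0 < K) {Γ : List circ.{u}.Srt}
    {e e' : N.Tuple (Var Γ)} (h : χ.Sim (2 * K) e e') (s : circ.{u}.Srt) (a : N.carrier s) :
    ∃ a', χ.Sim K (N.cons a e) (N.cons a' e') := by
  by_cases hs : s = n
  · subst hs
    have hfin : (χ.pairs e e').Finite := ((Set.finite_range _).insert _).insert _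
    obtain ⟨z', hz'⟩ := hΛ.exists_truncIso_insert hK hfin h.truncIso
      ⟨(u, u), .inl rfl, (χ.pos_mem a).1⟩ ⟨(v, v), .inr (.inl rfl), (χ.pos_mem a).2⟩
    have hu : u ≤ z' := (hz'.le_iff hK (p := (u, u)) (.inr (.inl rfl)) (.inl rfl)).1 (χ.pos_mem a).1
    have hv : z' < v := lt_of_not_ge fun hc => (χ.pos_mem a).2.not_ge
      ((hz'.le_iff hK (p := (v, v)) (.inr (.inr (.inl rfl))) (.inl rfl)).2 hc)
    obtain ⟨a', ha', hl⟩ := χ.exists_point z' ⟨hu, hv⟩ (χ.label a)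
    refine ⟨a', ⟨fun t ht x => ?_, fun x => ?_, hz'.mono le_rfl ?_⟩⟩
    · cases x with
      | zero => exact absurd rfl ht
      | succ x => exact h.eq_of_ne t ht x
    · cases x with
      | zero => exact hl.symm
      | succ x => exact h.label_eq x
    · rintro p (rfl | rfl | ⟨x, rfl⟩)
      · exact .inr (.inl rfl)
      · exact .inr (.inr (.inl rfl))
      · cases x with
        | zero => exact .inl (by rw [← ha']; rfl)
        | succ x => exact .inr (.inr (.inr ⟨x, rfl⟩))
  · refine ⟨a, ⟨fun t ht x => ?_, fun x => ?_, h.truncIso.mono (by omega) ?_⟩⟩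
    · cases x with
      | zero => rfl
      | succ x => exact h.eq_of_ne t ht x
    · cases x with
      | zero => exact absurd rfl hs
      | succ x => exact h.label_eq x
    · rintro p (rfl | rfl | ⟨x, rfl⟩)
      · exact .inl rfl
      · exact .inr (.inl rfl)
      · cases x with
        | zero => exact absurd rfl hs
        | succ x => exact .inr (.inr ⟨x, rfl⟩)

/-- Each quantifier halves the precision, hence the bound `2 ^ φ.depth`. At precision `1`, order and
labels are preserved, and in sort `n` they determine equality and the relation. -/
theorem Sim.realize_iff (hΛ : Divisible Λ) {Γ : List circ.{u}.Srt} (φ : circ.{u}.Formula Γ) :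
    ∀ {e e' : N.Tuple (Var Γ)}, χ.Sim (2 ^ φ.depth) e e' → (φ.Realize N e ↔ φ.Realize N e') := by
  induction φ with
  | falsum => exact fun _ => Iff.rfl
  | @eq Γ s t₁ t₂ =>
    intro e e' h
    rcases t₁ with x | ⟨f, _⟩
    rotate_left
    · exact isEmptyElim f
    rcases t₂ with y | ⟨f, _⟩
    rotate_left
    · exact isEmptyElim f
    change e s x = e s y ↔ e' s x = e' s y
    by_cases hs : s = n
    · subst hs
      have key : ∀ {e e' : N.Tuple (Var Γ)}, χ.Sim 1 e e' → e s x = e s y → e' s x = e' s y := by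
        intro e e' h hxy
        refine χ.ext _ _ (le_antisymm ?_ ?_) ?_
        · exact (h.pos_le_iff one_pos x y).1 (by rw [hxy])
        · exact (h.pos_le_iff one_pos y x).1 (by rw [hxy])
        · rw [← h.label_eq, ← h.label_eq, hxy]
      exact ⟨key h, key h.symm⟩
    · rw [h.eq_of_ne s hs, h.eq_of_ne s hs]
  | @rel Γ ar R ts =>
    intro e e' h
    suffices main : ∀ (m : circ.{u}.Srt) (ts : ∀ t, Var [m, m] t → circ.Term Γ t),
        (Formula.rel (arc m) ts).Realize N e ↔ (Formula.rel (arc m) ts).Realize N e' by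
      cases R with
      | arc m => exact main m ts
    intro m ts
    have hts : ∀ e : N.Tuple (Var Γ), (Formula.rel (arc m) ts).Realize N e ↔
        N.relMap (arc m) (Var.pair ((ts m .zero).realize N e)
          ((ts m (.succ .zero)).realize N e)) := fun e =>
      iff_of_eq (congrArg (N.relMap (arc m)) (Var.pair_eta fun t x => (ts t x).realize N e).symm)
    refine (hts e).trans (Iff.trans ?_ (hts e').symm)
    generalize ts m .zero = t₁
    generalize ts m (.succ .zero) = t₂
    rcases t₁ with x | ⟨f, _⟩
    rotate_left
    · exact isEmptyElim f
    rcases t₂ with y | ⟨f, _⟩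
    rotate_left
    · exact isEmptyElim f
    simp only [Term.realize]
    by_cases hs : m = n
    · subst hs
      rw [χ.relMap_iff, χ.relMap_iff, h.label_eq, h.label_eq, h.pos_le_iff one_pos,
        ← not_le, ← not_le, h.pos_le_iff one_pos]
    · rw [h.eq_of_ne m hs, h.eq_of_ne m hs]
  | imp φ ψ ihφ ihψ =>
    intro e e' h
    have hφ := ihφ (h.mono (Nat.pow_le_pow_right two_pos
      ((le_max_left _ _).trans (Nat.le_succ _))))
    have hψ := ihψ (h.mono (Nat.pow_le_pow_right two_pos
      ((le_max_right _ _).trans (Nat.le_succ _))))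
    simp only [Formula.Realize, hφ, hψ]
  | all s φ ih =>
    intro e e' h
    have key : ∀ {e e' : N.Tuple (Var _)}, χ.Sim (2 * 2 ^ φ.depth) e e' →
        (Formula.all s φ).Realize N e → (Formula.all s φ).Realize N e' := by
      intro e e' h H a'
      obtain ⟨a, ha⟩ := h.symm.forth hΛ (by positivity) s a'
      exact (ih ha).2 (H a)
    have h' : χ.Sim (2 * 2 ^ φ.depth) e e' := by
      rw [← pow_succ']
      exact h
    exact ⟨key h', key h'.symm⟩

/-- A substructure of a structure for a relational language. -/
def _root_.ManySorted.Lang.Str.restrict {L : Lang.{u}} [∀ ar s, IsEmpty (L.Fun ar s)] (N : L.Str)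
    (S : ∀ s, Set (N.carrier s)) (hS : ∀ s, (S s).Nonempty) : L.Str where
  carrier s := S s
  nonempty s := (hS s).to_subtype
  funMap f := isEmptyElim f
  relMap R e := N.relMap R fun s x => (e s x).1

variable (χ)

/-- The points whose position lies in `S` (if they are of sort `n`). -/
def keep (S : Set Λ) (s : circ.{u}.Srt) : Set (N.carrier s) :=
  {t | ∀ h : s = n, χ.pos (h ▸ t) ∈ S}

/-- The submodel keeps the other sorts entirely and, in sort `n`, the points with position in `S`.
It passes the Tarski–Vaught test because a witness may be moved into `S`, keeping its label and its
truncated distances to the parameters. Replacing `c₁` by `c₂` changes no distance to `S` or to the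
ends, hence no type over the submodel. -/
theorem exists_elementary_sameTypeOver (hΛ : Divisible Λ) {c₁ c₂ : Λ} (huv : u < v)
    (hc : SameCut u v c₁ c₂) :
    ∃ (M : circ.{u}.Str) (f : ∀ s, M.carrier s → N.carrier s), M.IsElementary N f ∧
      ∀ (V : circ.{u}.Srt → Type u) (a b : N.Tuple V), (∀ s, s ≠ n → ∀ x, a s x = b s x) →
        (∀ x, χ.label (a n x) = χ.label (b n x) ∧ χ.pos (a n x) = c₁ ∧ χ.pos (b n x) = c₂) →
        N.SameTypeOver f a b := by
  obtain ⟨S, hS, hdense, hgap⟩ := hc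
  have hne : ∀ s, (χ.keep S s).Nonempty := by
    intro s
    by_cases hs : s = n
    · subst hs
      -- Density over the empty set is used only to see that `S` is nonempty.
      obtain ⟨z, hz, _⟩ := hdense ∅ (Set.empty_subset _) Set.finite_empty 0 u ⟨le_rfl, huv⟩
      obtain ⟨t, ht, _⟩ := χ.exists_point z (hS hz) 0
      exact ⟨t, fun _ => ht ▸ hz⟩
    · exact ⟨(N.nonempty s).some, fun h => absurd h hs⟩
  refine ⟨N.restrict (χ.keep S) hne, fun s t => t.1, ?_, ?_⟩
  · refine Str.isElementary_of_tarskiVaught (fun s => Subtype.val_injective)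
      (fun _ _ _ => Iff.rfl) ?_
    intro Γ s φ e a ha
    by_cases hs : s = n
    · subst hs
      obtain ⟨z', hz', hzz'⟩ := hdense (Set.range fun x => χ.pos (e s x).1)
        (by rintro _ ⟨x, rfl⟩; exact (e s x).2 rfl) (Set.finite_range _) (2 ^ φ.depth)
        (χ.pos a) (χ.pos_mem a)
      obtain ⟨t, ht, hl⟩ := χ.exists_point z' (hS hz') (χ.label a)
      refine ⟨⟨t, fun _ => ht ▸ hz'⟩, ((Sim.realize_iff (χ := χ) hΛ φ ?_).1 ha)⟩
      refine ⟨fun s' hs' x => ?_, fun x => ?_, ?_⟩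
      · cases x with
        | zero => exact absurd rfl hs'
        | succ x => rfl
      · cases x with
        | zero => exact hl.symm
        | succ x => rfl
      · have hor : ∀ p ∈ χ.pairs (N.cons a fun s x => (e s x).1) (N.cons t fun s x => (e s x).1),
            p = (χ.pos a, z') ∨ (p.1 = p.2 ∧
              p.1 ∈ insert u (insert v (Set.range fun x => χ.pos (e s x).1))) := by
          rintro p (rfl | rfl | ⟨x, rfl⟩)
          · exact .inr ⟨rfl, .inl rfl⟩
          · exact .inr ⟨rfl, .inr (.inl rfl)⟩
          · cases x with
            | zero => exact .inl (by rw [← ht]; rfl)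
            | succ x => exact .inr ⟨rfl, .inr (.inr ⟨x, rfl⟩)⟩
        intro p hp q hq
        rcases hor p hp with rfl | ⟨hp1, hp2⟩ <;> rcases hor q hq with rfl | ⟨hq1, hq2⟩
        · exact .inl (by rw [gapCard_eq_zero.2 le_rfl, gapCard_eq_zero.2 le_rfl])
        · rw [← hq1]
          exact (hzz' _ hq2).2
        · rw [← hp1]
          exact (hzz' _ hp2).1
        · rw [← hp1, ← hq1]
          exact .refl _ _
    · exact ⟨⟨a, fun h => absurd h hs⟩, ha⟩
  · intro V a b hab hn Γ φ σ
    refine Sim.realize_iff (χ := χ) hΛ φ ⟨fun s hs x => ?_, fun x => ?_, ?_⟩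
    · rcases σ s x with y | y
      · exact hab s hs y
      · rfl
    · rcases σ n x with y | y
      · exact (hn y).1
      · rfl
    · have hor : ∀ p ∈ χ.pairs (fun s x => Sum.elim (a s) (fun t => t.1) (σ s x) : N.Tuple (Var Γ))
          (fun s x => Sum.elim (b s) (fun t => t.1) (σ s x)),
          p = (c₁, c₂) ∨ (p.1 = p.2 ∧ p.1 ∈ insert u (insert v S)) := by
        rintro p (rfl | rfl | ⟨x, rfl⟩)
        · exact .inr ⟨rfl, .inl rfl⟩
        · exact .inr ⟨rfl, .inr (.inl rfl)⟩
        · simp only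
          rcases σ n x with y | y
          · exact .inl (Prod.ext (hn y).2.1 (hn y).2.2)
          · exact .inr ⟨rfl, .inr (.inr (y.2 rfl))⟩
      intro p hp q hq
      rcases hor p hp with rfl | ⟨hp1, hp2⟩ <;> rcases hor q hq with rfl | ⟨hq1, hq2⟩
      · exact .inl (by rw [gapCard_eq_zero.2 le_rfl, gapCard_eq_zero.2 le_rfl])
      · rw [← hq1]
        exact .inl (hgap _ hq2).2
      · rw [← hp1]
        exact .inl (hgap _ hp2).1
      · rw [← hp1, ← hq1]
        exact .refl _ _

end Chart

end Lang

end ManySorted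

/-! ### The circles and the walk around them -/

namespace ManySorted

open Cardinal Filter

namespace Lang

/-- The sort `n` consists of `2 * n + 2` copies of `J`, arranged on a circle; the relation says that
the second point lies less than one turn of a copy of `J` ahead of the first. -/
def circStr (J : Type u) [LinearOrder J] [Nonempty J] : circ.{u}.Str where
  carrier n := J × ZMod (2 * n.down + 2)
  nonempty _ := inferInstance
  funMap f _ := isEmptyElim f
  relMap R e := match R with
    | .arc n => ((e n (.succ .zero)).2 = (e n .zero).2 ∧ (e n .zero).1 ≤ (e n (.succ .zero)).1) ∨
        ((e n (.succ .zero)).2 = (e n .zero).2 + 1 ∧ (e n (.succ .zero)).1 < (e n .zero).1)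

section

variable {J : Type u} [LinearOrder J] [Nonempty J]

theorem circStr_relMap (n : circ.{u}.Srt) (e : (circStr J).Tuple (Var [n, n])) :
    (circStr J).relMap (arc n) e ↔
      ((e n (.succ .zero)).2 = (e n .zero).2 ∧ (e n .zero).1 ≤ (e n (.succ .zero)).1) ∨
        ((e n (.succ .zero)).2 = (e n .zero).2 + 1 ∧ (e n (.succ .zero)).1 < (e n .zero).1) :=
  Iff.rfl

/-- The chart which cuts the circle at the copies of the point `c`. -/
def circChart (n : circ.{u}.Srt) (c : J) :
    Chart (circStr J) n (Λ := ℤ ×ₗ J) (toLex (0, c)) (toLex (1, c))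
      (ZMod (2 * n.down + 2)) where
  -- A turn runs from `c` in one copy to `c` in the next. A point below `c` therefore lies at the
  -- end of the turn that began one copy earlier: its position has first coordinate `1` and its
  -- label drops by one.
  pos t := if c ≤ t.1 then toLex (0, t.1) else toLex (1, t.1)
  label t := if c ≤ t.1 then t.2 else t.2 - 1
  pos_mem := by
    rintro ⟨x, i⟩
    by_cases h : c ≤ x
    · simp [h, Prod.Lex.toLex_le_toLex, Prod.Lex.toLex_lt_toLex]
    · simp [h, Prod.Lex.toLex_le_toLex, Prod.Lex.toLex_lt_toLex, lt_of_not_ge h]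
  ext := by
    rintro ⟨x, i⟩ ⟨y, j⟩
    by_cases h : c ≤ x <;> by_cases h' : c ≤ y <;> simp +contextual [h, h']
    all_goals exact fun _ _ => rfl
  exists_point := by
    rintro z ⟨hz1, hz2⟩ l
    obtain ⟨⟨k, x⟩, rfl⟩ := toLex.surjective z
    simp only [Prod.Lex.toLex_le_toLex, Prod.Lex.toLex_lt_toLex] at hz1 hz2
    by_cases h : c ≤ x
    · have : k = 0 := by
        have := h.not_gt
        rcases hz1 with hz1 | hz1 <;> rcases hz2 with hz2 | hz2 <;> first | omega | tauto
      subst this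
      exact ⟨(x, l), by simp [h]⟩
    · have : k = 1 := by
        rcases hz1 with hz1 | hz1 <;> rcases hz2 with hz2 | hz2 <;> first | omega | tauto
      subst this
      exact ⟨(x, l + 1), by simp [h]⟩
  relMap_iff := by
    rintro ⟨x, i⟩ ⟨y, j⟩
    rw [circStr_relMap]
    change ((j = i ∧ x ≤ y) ∨ (j = i + 1 ∧ y < x)) ↔ _
    have h10 : ¬ (1 : ℤ) < 0 := by omega
    by_cases h : c ≤ x <;> by_cases h' : c ≤ y
    · simp [h, h', Prod.Lex.toLex_le_toLex, Prod.Lex.toLex_lt_toLex]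
    · have h1 : y < x := (lt_of_not_ge h').trans_le h
      simp [h, h', Prod.Lex.toLex_le_toLex, Prod.Lex.toLex_lt_toLex, h1, h1.not_ge, h10,
        sub_eq_iff_eq_add]
    · have h1 : x < y := (lt_of_not_ge h).trans_le h'
      simp [h, h', Prod.Lex.toLex_le_toLex, Prod.Lex.toLex_lt_toLex, h1.le, h1.not_gt, h10]
    · simp [h, h', Prod.Lex.toLex_le_toLex, Prod.Lex.toLex_lt_toLex, sub_eq_iff_eq_add]

/-- Between `d` and `d'` as well as between `d'` and the next copy of `d` there is no obstacle to
moving by automorphisms over a small submodel. -/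
structure Movable (d d' : J) : Prop where
  divisible : Divisible (ℤ ×ₗ J)
  exists_cut : ∃ c₀ c : J, c₀ ≤ d ∧ d < c ∧ c ≤ d' ∧
    SameCut (toLex (0, c₀) : ℤ ×ₗ J) (toLex (1, c₀)) (toLex (0, d))
      (toLex (0, d')) ∧
    SameCut (toLex (0, c) : ℤ ×ₗ J) (toLex (1, c)) (toLex (0, d'))
      (toLex (1, d))

/-- A zigzag walk around the circle of sort `n`. -/
def walk (d d' : J) (n : circ.{u}.Srt) (k : ℕ) : (circStr J).Tuple fun _ => PUnit.{u + 1} :=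
  fun s _ => if s = n then (if Even k then d else d', ((k / 2 : ℕ) : ZMod (2 * s.down + 2)))
    else (d, 0)

theorem walk_of_ne (d d' : J) {n s : circ.{u}.Srt} (h : s ≠ n) (k : ℕ) (x : PUnit.{u + 1}) :
    walk d d' n k s x = ((d, 0) : J × ZMod (2 * s.down + 2)) :=
  if_neg h

theorem walk_even (d d' : J) (n : circ.{u}.Srt) {k q : ℕ} (h : k = 2 * q) (x : PUnit.{u + 1}) :
    walk d d' n k n x = ((d, (q : ZMod (2 * n.down + 2))) : J × ZMod (2 * n.down + 2)) := by
  refine (if_pos rfl).trans ?_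
  have h2 : k / 2 = q := by omega
  rw [if_pos ⟨q, by omega⟩, h2]

theorem walk_odd (d d' : J) (n : circ.{u}.Srt) {k q : ℕ} (h : k = 2 * q + 1) (x : PUnit.{u + 1}) :
    walk d d' n k n x = ((d', (q : ZMod (2 * n.down + 2))) : J × ZMod (2 * n.down + 2)) := by
  refine (if_pos rfl).trans ?_
  have h2 : k / 2 = q := by omega
  rw [if_neg (by rw [Nat.not_even_iff_odd]; exact ⟨q, h⟩), h2]

theorem walk_zero (d d' : J) (n s : circ.{u}.Srt) (x : PUnit.{u + 1}) :
    walk d d' n 0 s x = ((d, 0) : J × ZMod (2 * s.down + 2)) := by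
  by_cases h : s = n
  · subst h
    exact (walk_even d d' s (q := 0) rfl x).trans (by rw [Nat.cast_zero])
  · exact walk_of_ne d d' h 0 x

/-- From `d` to `d'` in the same copy the circle is cut at `c₀`, which precedes both. From `d'` to
the next `d` it is cut at `c`, which separates them: in that chart the next `d` has the same label
as `d'`. -/
theorem walk_sameTypeOver {d d' : J} (h : Movable d d') (n : circ.{u}.Srt) (k : ℕ) :
    ∃ (M : circ.{u}.Str) (f : ∀ s, M.carrier s → (circStr J).carrier s),
      M.IsElementary (circStr J) f ∧
      (circStr J).SameTypeOver f (walk d d' n k) (walk d d' n (k + 1)) := by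
  obtain ⟨c₀, c, h1, h2, h3, hc₀, hc⟩ := h.exists_cut
  have hlt : ∀ c : J, (toLex (0, c) : ℤ ×ₗ J) < toLex (1, c) := fun c => by
    simp [Prod.Lex.toLex_lt_toLex]
  rcases Nat.even_or_odd' k with ⟨q, hq | hq⟩
  · obtain ⟨M, f, hf, H⟩ :=
      (circChart n c₀).exists_elementary_sameTypeOver h.divisible (hlt c₀) hc₀
    refine ⟨M, f, hf, H _ _ _ (fun s hs x => ?_) fun x => ?_⟩
    · rw [walk_of_ne d d' hs, walk_of_ne d d' hs]
    · have hd' : c₀ ≤ d' := h1.trans (h2.le.trans h3)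
      rw [walk_even d d' n hq, walk_odd d d' n (k := k + 1) (q := q) (by omega)]
      simp [circChart, h1, hd']
  · obtain ⟨M, f, hf, H⟩ :=
      (circChart n c).exists_elementary_sameTypeOver h.divisible (hlt c) hc
    refine ⟨M, f, hf, H _ _ _ (fun s hs x => ?_) fun x => ?_⟩
    · rw [walk_of_ne d d' hs, walk_of_ne d d' hs]
    · rw [walk_odd d d' n hq, walk_even d d' n (k := k + 1) (q := q + 1) (by omega)]
      simp [circChart, h2, h3]

/-- Each step has a submodel of the circle itself as witness, and this remains elementary in the
ultrapower along the diagonal. -/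
theorem walk_lascarChain {d d' : J} (h : Movable d d') (n : circ.{u}.Srt) (k : ℕ) :
    (circStr J).ultrapower.LascarChain k (fun s x => (circStr J).diag s (walk d d' n 0 s x))
      (fun s x => (circStr J).diag s (walk d d' n k s x)) := by
  refine ⟨fun j s x => (circStr J).diag s (walk d d' n j s x), rfl, rfl, fun i _ => ?_⟩
  obtain ⟨M, f, hf, H⟩ := walk_sameTypeOver h n i
  exact ⟨M, _, hf.comp (Str.diag_isElementary _), H.map (Str.diag_isElementary _)⟩

/-! ### The lower bound for the Lascar distance -/

theorem exists_tuple_of_list {L : Lang.{u}} (N : L.Str) (s : L.Srt) (l : List (N.carrier s)) :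
    ∃ (Γ : List L.Srt) (y : N.Tuple (Var Γ)), ∀ a ∈ l, ∃ x : Var Γ s, y s x = a := by
  induction l with
  | nil => exact ⟨[], N.nil, by simp⟩
  | cons a l ih =>
    obtain ⟨Γ, y, hy⟩ := ih
    refine ⟨s :: Γ, N.cons a y, fun b hb => ?_⟩
    rcases List.mem_cons.1 hb with rfl | hb
    · exact ⟨.zero, rfl⟩
    · obtain ⟨x, hx⟩ := hy b hb
      exact ⟨.succ x, hx⟩

/-- Finitely many points of any elementary substructure of an elementary extension of the circle
suffice to cover each sort. -/
theorem exists_relMap_of_elementary {C M : circ.{u}.Str}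
    {g : ∀ s, (circStr J).carrier s → C.carrier s} (hg : (circStr J).IsElementary C g)
    {f : ∀ s, M.carrier s → C.carrier s} (hf : M.IsElementary C f) (n : circ.{u}.Srt)
    (t : C.carrier n) : ∃ m : M.carrier n, C.relMap (arc n) (Var.pair (f n m) t) := by
  let c : J := Classical.arbitrary J
  -- The cover consists of one point in each copy, all at the same height `c`.
  obtain ⟨Γ, y, hy⟩ := exists_tuple_of_list (circStr J) n
    ((Finset.univ : Finset (ZMod (2 * n.down + 2))).toList.map fun i => (c, i))
  obtain ⟨φ, hφ⟩ := Formula.exists_disj (L := circ.{u}) (Γ := n :: Γ) fun x : Var Γ n =>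
    .rel (arc n) (Var.pair (.var x.succ) (.var .zero))
  have hφ' : ∀ (M : circ.{u}.Str) (e : M.Tuple (Var Γ)), (Formula.all n φ).Realize M e ↔
      ∀ t, ∃ x, M.relMap (arc n) (Var.pair (e n x) t) := by
    intro M e
    refine forall_congr' fun t => (hφ M _).trans (exists_congr fun x => ?_)
    refine iff_of_eq (congrArg (M.relMap (arc n)) ?_)
    exact Var.map_pair (fun s (τ : circ.Term (n :: Γ) s) => τ.realize M (M.cons t e)) _ _
  -- The cover is quantified existentially, so that a sentence passes through `C` to `M` and yields
  -- a cover inside `M`. The formula stating that it is a cover then goes back up to `C`.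
  let ψ : circ.{u}.Sentence := ((Formula.all n φ).rename fun _ => Var.inl (Δ := [])).exs
  have hψ : ∀ M : circ.{u}.Str, ψ.Realize M M.nil ↔
      ∃ e : M.Tuple (Var Γ), ∀ t, ∃ x, M.relMap (arc n) (Var.pair (e n x) t) := by
    intro M
    rw [Formula.realize_exs]
    simp only [Formula.realize_rename, Str.append_inl, hφ']
  have hnil : ∀ {M C : circ.{u}.Str} {f : ∀ s, M.carrier s → C.carrier s}, M.IsElementary C f →
      (ψ.Realize C C.nil ↔ ψ.Realize M M.nil) := by
    intro M C f hf
    rw [← hf]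
    exact iff_of_eq (congrArg _ (by funext s x; nomatch x))
  have h1 : ψ.Realize (circStr J) (circStr J).nil := by
    refine (hψ _).2 ⟨y, ?_⟩
    rintro ⟨x, i⟩
    have hpt : ∀ l : ZMod (2 * n.down + 2), ∃ v : Var Γ n, y n v = (c, l) := fun l =>
      hy _ (List.mem_map.2 ⟨l, by simp, rfl⟩)
    by_cases h : c ≤ x
    · obtain ⟨v, hv⟩ := hpt i
      refine ⟨v, (circStr_relMap n _).2 ?_⟩
      change (i = (y n v).2 ∧ (y n v).1 ≤ x) ∨ (i = (y n v).2 + 1 ∧ x < (y n v).1)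
      rw [hv]
      exact .inl ⟨rfl, h⟩
    · obtain ⟨v, hv⟩ := hpt (i - 1)
      refine ⟨v, (circStr_relMap n _).2 ?_⟩
      change (i = (y n v).2 ∧ (y n v).1 ≤ x) ∨ (i = (y n v).2 + 1 ∧ x < (y n v).1)
      rw [hv]
      exact .inr ⟨(sub_add_cancel i 1).symm, lt_of_not_ge h⟩
  obtain ⟨e, he⟩ := (hψ M).1 ((hnil hf).1 ((hnil hg).2 h1))
  obtain ⟨x, hx⟩ := (hφ' C _).1 ((hf _ _ e).2 ((hφ' M e).2 he)) t
  exact ⟨e n x, hx⟩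

/-- The point behind `a` may be taken in the submodel, and then being ahead of it is part of the
type over the submodel. -/
theorem exists_relMap_of_sameTypeOver {C M : circ.{u}.Str}
    {g : ∀ s, (circStr J).carrier s → C.carrier s} (hg : (circStr J).IsElementary C g)
    {f : ∀ s, M.carrier s → C.carrier s} (hf : M.IsElementary C f) (n : circ.{u}.Srt)
    {V : circ.{u}.Srt → Type u} {a b : C.Tuple V} (h : C.SameTypeOver f a b) (v : V n) :
    ∃ w, C.relMap (arc n) (Var.pair w (a n v)) ∧ C.relMap (arc n) (Var.pair w (b n v)) := by
  obtain ⟨m, hm⟩ := exists_relMap_of_elementary hg hf n (a n v)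
  have key : ∀ a : C.Tuple V,
      (Formula.rel (arc n) fun _ x => .var x : circ.{u}.Formula [n, n]).Realize C
        (fun s x => Sum.elim (a s) (f s) (Var.pair (F := fun s => V s ⊕ M.carrier s)
          (.inr m) (.inl v) s x)) ↔ C.relMap (arc n) (Var.pair (f n m) (a n v)) := fun a =>
    iff_of_eq (congrArg (C.relMap (arc n))
      (Var.map_pair (fun s => Sum.elim (a s) (f s)) (s := n) (.inr m) (.inl v)))
  exact ⟨f n m, hm, (key b).1 ((h _ _ _).1 ((key a).2 hm))⟩

/-- Points of the ultrapower whose labels differ by at most `k`. -/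
def LabelNear (n : circ.{u}.Srt) (k : ℕ) (x y : (circStr J).ultrapower.carrier n) : Prop :=
  ∀ᶠ i in (hyperfilter ℕ : Filter ℕ), ∃ z : ℤ, |z| ≤ k ∧
    (germRep y i).2 = (germRep x i).2 + (z : ZMod (2 * n.down + 2))

/-- In almost every coordinate, both labels equal that of `w` or its successor. -/
theorem labelNear_of_relMap {n : circ.{u}.Srt} {w x y : (circStr J).ultrapower.carrier n}
    (hx : (circStr J).ultrapower.relMap (arc n) (Var.pair w x))
    (hy : (circStr J).ultrapower.relMap (arc n) (Var.pair w y)) : LabelNear n 1 x y := by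
  have hx' : ∀ᶠ i in (hyperfilter ℕ : Filter ℕ), (circStr J).relMap (arc n) _ := hx
  have hy' : ∀ᶠ i in (hyperfilter ℕ : Filter ℕ), (circStr J).relMap (arc n) _ := hy
  filter_upwards [hx', hy'] with i h1 h2
  rw [circStr_relMap] at h1 h2
  simp only [Var.pair] at h1 h2
  rcases h1 with ⟨h1, _⟩ | ⟨h1, _⟩ <;> rcases h2 with ⟨h2, _⟩ | ⟨h2, _⟩ <;> rw [h1, h2]
  · exact ⟨0, by simp⟩
  · exact ⟨1, by simp⟩
  · exact ⟨-1, by simp⟩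
  · exact ⟨0, by simp⟩

theorem LabelNear.trans {n : circ.{u}.Srt} {j k : ℕ} {x y z : (circStr J).ultrapower.carrier n}
    (h : LabelNear n j x y) (h' : LabelNear n k y z) : LabelNear n (j + k) x z := by
  filter_upwards [h, h'] with i h1 h2
  obtain ⟨a, ha, h1⟩ := h1
  obtain ⟨b, hb, h2⟩ := h2
  refine ⟨a + b, (abs_add_le a b).trans (by push_cast; gcongr), ?_⟩
  rw [h2, h1]
  push_cast
  ring

theorem labelNear_of_lascarChain {V : circ.{u}.Srt → Type u} {k : ℕ}
    {a b : (circStr J).ultrapower.Tuple V} (h : (circStr J).ultrapower.LascarChain k a b)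
    (n : circ.{u}.Srt) (v : V n) : LabelNear n k (a n v) (b n v) := by
  obtain ⟨c, rfl, rfl, hc⟩ := h
  suffices H : ∀ j ≤ k, LabelNear n j (c 0 n v) (c j n v) from H k le_rfl
  intro j
  induction j with
  | zero => exact fun _ => .of_forall fun i => ⟨0, by simp⟩
  | succ j ih =>
    intro hj
    obtain ⟨M, f, hf, H⟩ := hc j (by omega)
    obtain ⟨w, h1, h2⟩ := exists_relMap_of_sameTypeOver (Str.diag_isElementary (circStr J)) hf n H v
    exact (ih (by omega)).trans (labelNear_of_relMap h1 h2)

/-- After `2 * (n + 1)` steps the label is `n + 1`, the antipode of `0` modulo `2 * n + 2`. No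
integer of absolute value at most `n` is congruent to it. -/
theorem not_lascarChain_walk (d d' : J) (n : circ.{u}.Srt) {k : ℕ} (hk : k ≤ n.down) :
    ¬ (circStr J).ultrapower.LascarChain k
      (fun s x => (circStr J).diag s (walk d d' n 0 s x))
      (fun s x => (circStr J).diag s (walk d d' n (2 * (n.down + 1)) s x)) := by
  intro h
  have h1 := labelNear_of_lascarChain h n PUnit.unit
  have h2 : ∀ k, germRep ((circStr J).diag n (walk d d' n k n PUnit.unit)) =ᶠ[hyperfilter ℕ]
      fun _ => walk d d' n k n PUnit.unit := fun k => germRep_coe _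
  obtain ⟨i, ⟨z, hz, hlab⟩, h3, h4⟩ := (h1.and ((h2 0).and (h2 (2 * (n.down + 1))))).exists
  rw [h3.trans (walk_zero d d' n n _), h4.trans (walk_even d d' n (q := n.down + 1) rfl _)] at hlab
  generalize n.down = n at *
  have hlab' : ((n + 1 : ℕ) : ZMod (2 * n + 2)) = (z : ZMod (2 * n + 2)) := by
    simpa using hlab
  have h5 : (((n + 1 : ℕ) : ℤ) : ZMod (2 * n + 2)) = (z : ZMod (2 * n + 2)) := by
    rw [← hlab']
    push_cast
    rfl
  rw [ZMod.intCast_eq_intCast_iff_dvd_sub] at h5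
  obtain ⟨q, hq⟩ := h5
  have hz' := abs_le.1 hz
  push_cast at hq
  have hkn : (k : ℤ) ≤ n := by exact_mod_cast hk
  rcases le_or_gt q (-1) with h | h
  · nlinarith
  rcases le_or_gt 0 q with h' | h'
  · nlinarith
  · omega

/-- Given a bound `n` for the diameter, the walk in the sort `n` to the antipode ends at finite
Lascar distance, but that distance exceeds `n`. -/
theorem circStr_not_isGCompact {d d' : J} (h : Movable d d') :
    ¬ (circStr J).theory.IsGCompact := by
  intro H
  -- The sort is immaterial: all walks start at the same tuple. The base tuple must be fixed before
  -- `n` is known.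
  let m₀ : circ.{u}.Srt := ⟨0⟩
  have hcount : ∀ Γ, Countable (circ.{u}.Formula Γ) := Formula.countable
  have hV : #(Σ _ : circ.{u}.Srt, PUnit.{u + 1}) < (ℵ₁ : Cardinal.{u}) := by
    rw [← Cardinal.succ_aleph0, Order.lt_succ_iff]
    exact mk_le_aleph0
  obtain ⟨n, hn⟩ := H ℵ₁ card_circ_add_lt (circStr J).ultrapower
    (((Str.diag_isElementary _).isModel_iff _).2 fun φ hφ => hφ)
    (Str.ultrapower_isSaturated _) (fun _ => PUnit.{u + 1}) hV
    (fun s x => (circStr J).diag s (walk d d' m₀ 0 s x))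
  have h0 : ∀ n : circ.{u}.Srt, walk d d' n 0 = walk d d' m₀ 0 := by
    intro n
    funext s x
    rw [walk_zero, walk_zero]
  let m : circ.{u}.Srt := ⟨n⟩
  rw [← h0 m] at hn
  have hfin := walk_lascarChain h m (2 * (n + 1))
  set a : (circStr J).ultrapower.Tuple fun _ => PUnit.{u + 1} :=
    fun s x => (circStr J).diag s (walk d d' m 0 s x)
  set b : (circStr J).ultrapower.Tuple fun _ => PUnit.{u + 1} :=
    fun s x => (circStr J).diag s (walk d d' m (2 * (n + 1)) s x)
  have hmem : (circStr J).ultrapower.lascarDist a b ∈ {d : ℕ∞ | ∃ n : ℕ, d = n ∧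
      (circStr J).ultrapower.LascarChain n a b} :=
    csInf_mem (show Set.Nonempty _ from ⟨((2 * (n + 1) : ℕ) : ℕ∞), _, rfl, hfin⟩)
  obtain ⟨k, hk, hchain⟩ := hmem
  have hle := hn b (hk ▸ ENat.natCast_lt_top k)
  rw [hk] at hle
  exact not_lascarChain_walk d d' m (Nat.cast_le.1 hle) hchain

end

end Lang

end ManySorted

/-! ### Finding movable pairs -/

namespace ManySorted

open Filter

namespace Lang

variable {J : Type u} [LinearOrder J]

/-- The absence of a maximum keeps `ℤ ×ₗ J` dense at the boundary between consecutive copies. -/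
theorem movable_of_dense [Nonempty J] [DenselyOrdered J] [NoMaxOrder J] {c₀ d c d' : J}
    (h1 : c₀ < d) (h2 : d < c) (h3 : c < d') : Movable d d' := by
  refine ⟨divisible_of_dense, c₀, c, h1.le, h2, h3.le, sameCut_of_dense ?_ ?_,
    sameCut_of_dense ?_ ?_⟩
  · simp [Prod.Lex.toLex_lt_toLex, h1, h1.trans (h2.trans h3)]
  · simp [Prod.Lex.toLex_lt_toLex]
  · simp [Prod.Lex.toLex_lt_toLex, h3]
  · simp [Prod.Lex.toLex_lt_toLex, h2]

theorem gapCard_toLex_eq_top {x y : J} (h : gapCard x y = ⊤) (k : ℤ) :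
    gapCard (toLex (k, x)) (toLex (k, y)) = ⊤ := by
  rw [gapCard, Set.encard_eq_top_iff] at h ⊢
  refine (h.image (f := fun z => toLex (k, z)) fun a _ b _ hab => by simpa using hab).mono ?_
  rintro _ ⟨z, ⟨hz1, hz2⟩, rfl⟩
  exact ⟨by simp [Prod.Lex.toLex_le_toLex, hz1], by simp [Prod.Lex.toLex_lt_toLex, hz2]⟩

theorem toLex_covBy {x y : J} (h : x ⋖ y) (k : ℤ) : toLex (k, x) ⋖ toLex (k, y) := by
  refine ⟨by simp [Prod.Lex.toLex_lt_toLex, h.lt], fun z hz1 hz2 => ?_⟩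
  obtain ⟨⟨l, z⟩, rfl⟩ := toLex.surjective z
  simp only [Prod.Lex.toLex_lt_toLex] at hz1 hz2
  rcases hz1 with hz1 | ⟨rfl, hz1⟩
  · rcases hz2 with hz2 | ⟨hz2, _⟩ <;> omega
  · rcases hz2 with hz2 | ⟨_, hz2⟩
    · omega
    · exact h.2 hz1 hz2

theorem toLex_covBy_succ {m M : J} (hm : IsBot m) (hM : IsTop M) (k : ℤ) :
    toLex (k, M) ⋖ toLex (k + 1, m) := by
  refine ⟨by simp [Prod.Lex.toLex_lt_toLex], fun z hz1 hz2 => ?_⟩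
  obtain ⟨⟨l, z⟩, rfl⟩ := toLex.surjective z
  simp only [Prod.Lex.toLex_lt_toLex] at hz1 hz2
  rcases hz1 with hz1 | ⟨rfl, hz1⟩
  · rcases hz2 with hz2 | ⟨rfl, hz2⟩
    · omega
    · exact (hm z).not_gt hz2
  · exact (hM z).not_gt hz1

/-- The top of each copy is followed immediately by the bottom of the next, so `ℤ ×ₗ J` is discrete
without ends. The four infinite gaps keep `d` and `d'` infinitely far from the cutting points on
both sides. -/
theorem movable_of_discrete [Nonempty J] {m M : J} (hm : IsBot m) (hM : IsTop M)
    (hs : ∀ x, x ≠ M → ∃ y, x ⋖ y) (hp : ∀ y, y ≠ m → ∃ x, x ⋖ y) {c₀ d c d' : J}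
    (h1 : gapCard c₀ d = ⊤) (h2 : gapCard d c = ⊤) (h3 : gapCard c d' = ⊤)
    (h4 : gapCard d' M = ⊤) : Movable d d' := by
  have hs' : ∀ x : ℤ ×ₗ J, ∃ y, x ⋖ y := by
    intro x
    obtain ⟨⟨k, x⟩, rfl⟩ := toLex.surjective x
    by_cases hx : x = M
    · exact hx ▸ ⟨_, toLex_covBy_succ hm hM k⟩
    · obtain ⟨y, hy⟩ := hs x hx
      exact ⟨_, toLex_covBy hy k⟩
  have hp' : ∀ y : ℤ ×ₗ J, ∃ x, x ⋖ y := by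
    intro y
    obtain ⟨⟨k, y⟩, rfl⟩ := toLex.surjective y
    by_cases hy : y = m
    · refine hy ▸ ⟨toLex (k - 1, M), ?_⟩
      have := toLex_covBy_succ hm hM (k - 1)
      rwa [sub_add_cancel] at this
    · obtain ⟨x, hx⟩ := hp y hy
      exact ⟨_, toLex_covBy hx k⟩
  have hlt : ∀ {x y : J}, gapCard x y = ⊤ → x < y := fun h => lt_of_not_ge fun h' => by
    rw [gapCard_eq_zero.2 h'] at h
    exact ENat.top_ne_zero h.symm
  have up : ∀ {x y z w : ℤ ×ₗ J}, gapCard y z = ⊤ → x ≤ y → z ≤ w → gapCard x w = ⊤ :=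
    fun h hx hy => top_le_iff.1 (h ▸ gapCard_mono hx hy)
  have le01 : ∀ x y : J, (toLex (0, x) : ℤ ×ₗ J) ≤ toLex (1, y) := fun x y => by
    simp [Prod.Lex.toLex_le_toLex]
  have le00 : ∀ {x y : J} (k : ℤ), x ≤ y → (toLex (k, x) : ℤ ×ₗ J) ≤ toLex (k, y) :=
    fun k h => by simp [Prod.Lex.toLex_le_toLex, h]
  refine ⟨divisible_of_discrete hs' hp', c₀, c, (hlt h1).le, hlt h2, (hlt h3).le,
    sameCut_of_discrete hs' ?_ ?_ ?_ ?_, sameCut_of_discrete hs' ?_ ?_ ?_ ?_⟩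
  · exact gapCard_toLex_eq_top h1 0
  · exact up (gapCard_toLex_eq_top h1 0) le_rfl (le00 0 ((hlt h2).trans (hlt h3)).le)
  · exact up (gapCard_toLex_eq_top h2 0) le_rfl (le01 _ _)
  · exact up (gapCard_toLex_eq_top h4 0) le_rfl (le01 _ _)
  · exact gapCard_toLex_eq_top h3 0
  · exact up (gapCard_toLex_eq_top h3 0) le_rfl (le01 _ _)
  · exact up (gapCard_toLex_eq_top h4 0) le_rfl (le01 _ _)
  · exact gapCard_toLex_eq_top h2 1

/-! ### Orders with bounded finite intervals -/

section Bounded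

variable {X : Type u} [LinearOrder X]

/-- The elements without an immediate predecessor. -/
def limitPoints (X : Type u) [LinearOrder X] : Set X := {x | ∀ y < x, ∃ z, y < z ∧ z < x}

variable {K : ℕ} (hK : ∀ x y : X, (Set.Icc x y).Finite → (Set.Icc x y).ncard ≤ K)

include hK in
-- Descending from `w` through immediate predecessors enlarges a finite interval by one element each
-- time, so the bound `K` forces the descent to stop.
theorem exists_limitPoint_le (w : X) : ∃ z ∈ limitPoints X, z ≤ w ∧ (Set.Icc z w).Finite := by
  by_contra! hc
  have step : ∀ n : ℕ, ∃ z ≤ w, (Set.Icc z w).Finite ∧ n < (Set.Icc z w).ncard := by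
    intro n
    induction n with
    | zero => exact ⟨w, le_rfl, by simp, by simp⟩
    | succ n ih =>
      obtain ⟨z, hzw, hfin, hn⟩ := ih
      have hz : z ∉ limitPoints X := fun h => hc z h hzw hfin
      simp only [limitPoints, Set.mem_ofPred_eq, not_forall, not_exists, not_and, not_lt] at hz
      obtain ⟨y, hyz, hy⟩ := hz
      have heq : Set.Icc y w = insert y (Set.Icc z w) := by
        ext t
        simp only [Set.mem_Icc, Set.mem_insert_iff]
        constructor
        · rintro ⟨h1, h2⟩
          rcases h1.eq_or_lt with h1 | h1
          · exact .inl h1.symm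
          · exact .inr ⟨hy t h1, h2⟩
        · rintro (rfl | ⟨h1, h2⟩)
          · exact ⟨le_rfl, hyz.le.trans hzw⟩
          · exact ⟨hyz.le.trans h1, h2⟩
      refine ⟨y, hyz.le.trans hzw, heq ▸ hfin.insert y, ?_⟩
      rw [heq, Set.ncard_insert_of_notMem (fun h => h.1.not_gt hyz) hfin]
      omega
  obtain ⟨z, _, hfin, hn⟩ := step K
  exact (hK z w hfin).not_gt hn

theorem infinite_Ioo_of_limitPoint {x y : X} (hy : y ∈ limitPoints X) (hxy : x < y) :
    (Set.Ioo x y).Infinite := by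
  intro hfin
  obtain ⟨z, hz⟩ := hy x hxy
  obtain ⟨m, hm, hmax⟩ := Set.exists_max_image _ id hfin ⟨z, hz⟩
  obtain ⟨t, h1, h2⟩ := hy m hm.2
  exact (hmax t ⟨hm.1.trans h1, h2⟩).not_gt h1

include hK in
-- Take `K + 1` points between `x` and `y`, and descend from the greatest to a limit point through a
-- finite interval. That interval is too small to contain all of them, so the descent ends above
-- `x`.
theorem exists_limitPoint_between {x y : X} (hy : y ∈ limitPoints X) (hxy : x < y) :
    ∃ z ∈ limitPoints X, x < z ∧ z < y := by
  obtain ⟨F, hF, hcard⟩ := (infinite_Ioo_of_limitPoint hy hxy).exists_subset_card_eq (K + 1)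
  have hne : F.Nonempty := Finset.card_pos.1 (by omega)
  obtain ⟨w, hw, hmax⟩ := F.exists_max_image id hne
  obtain ⟨z, hz, hzw, hfin⟩ := exists_limitPoint_le hK w
  refine ⟨z, hz, lt_of_not_ge fun hzx => ?_, hzw.trans_lt (hF hw).2⟩
  have hsub : (F : Set X) ⊆ Set.Icc z w := fun t ht =>
    ⟨hzx.trans (hF ht).1.le, hmax t ht⟩
  have := Set.ncard_le_ncard hsub hfin
  rw [Set.ncard_coe_finset, hcard] at this
  have := hK z w hfin
  omega

include hK in
-- Descend from the least and from the greatest of `K + 1` points. If the second descent ended no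
-- higher than the first, its finite interval would contain all the points.
theorem exists_limitPoints_lt [Infinite X] :
    ∃ z₀ ∈ limitPoints X, ∃ z₁ ∈ limitPoints X, z₀ < z₁ := by
  obtain ⟨F, hcard⟩ := Infinite.exists_subset_card_eq X (K + 1)
  have hne : F.Nonempty := Finset.card_pos.1 (by omega)
  obtain ⟨w₁, hw₁, hmax⟩ := F.exists_max_image id hne
  obtain ⟨w₀, hw₀, hmin⟩ := F.exists_min_image id hne
  obtain ⟨z₀, hz₀, h0, _⟩ := exists_limitPoint_le hK w₀
  obtain ⟨z₁, hz₁, h1, hfin⟩ := exists_limitPoint_le hK w₁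
  refine ⟨z₀, hz₀, z₁, hz₁, lt_of_not_ge fun hle => ?_⟩
  have hsub : (F : Set X) ⊆ Set.Icc z₁ w₁ := fun t ht =>
    ⟨(hle.trans h0).trans (hmin t ht), hmax t ht⟩
  have := Set.ncard_le_ncard hsub hfin
  rw [Set.ncard_coe_finset, hcard] at this
  have := hK z₁ w₁ hfin
  omega

include hK in
-- Limit points are dense among themselves and accumulate below the limit point `b`, so omitting `b`
-- leaves a dense order without maximum.
theorem exists_movable_of_bounded [Infinite X] : ∃ (a b : X)
    (_ : Nonempty ↥(limitPoints X ∩ Set.Ico a b)) (d d' : ↥(limitPoints X ∩ Set.Ico a b)),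
    Movable d d' := by
  obtain ⟨a, ha, b, hb, hab⟩ := exists_limitPoints_lt hK
  let J : Set X := limitPoints X ∩ Set.Ico a b
  have hbet : ∀ x : J, ∀ y ∈ limitPoints X, (x : X) < y → y ≤ b → ∃ z : J, x < z ∧ (z : X) < y := by
    intro x y hy hxy hyb
    obtain ⟨z, hz, h1, h2⟩ := exists_limitPoint_between hK hy hxy
    exact ⟨⟨z, hz, x.2.2.1.trans h1.le, h2.trans_le hyb⟩, h1, h2⟩
  have : DenselyOrdered J := ⟨fun x y hxy => hbet x y y.2.1 hxy y.2.2.2.le⟩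
  have : NoMaxOrder J := ⟨fun x => (hbet x b hb x.2.2.2 le_rfl).imp fun _ h => h.1⟩
  have hne : Nonempty J := ⟨⟨a, ha, le_rfl, hab⟩⟩
  obtain ⟨d, hd⟩ := exists_gt (⟨a, ha, le_rfl, hab⟩ : J)
  obtain ⟨c, hc⟩ := exists_gt d
  obtain ⟨d', hd'⟩ := exists_gt c
  exact ⟨a, b, hne, d, d', movable_of_dense hd hc hd'⟩

end Bounded

/-! ### Orders with arbitrarily large finite intervals -/

section Unbounded

variable {X : Type u} [LinearOrder X]

theorem exists_covBy_right {x y r : X} (hfin : (Set.Icc x y).Finite) (h1 : x ≤ r) (h2 : r < y) :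
    ∃ s, r ⋖ s ∧ s ≤ y := by
  obtain ⟨s, hs, hmin⟩ := Set.exists_min_image (Set.Ioc r y) id
    (hfin.subset fun t ht => ⟨h1.trans ht.1.le, ht.2⟩) ⟨y, h2, le_rfl⟩
  exact ⟨s, ⟨hs.1, fun t h3 h4 => (hmin t ⟨h3, h4.le.trans hs.2⟩).not_gt h4⟩, hs.2⟩

theorem exists_covBy_left {x y r : X} (hfin : (Set.Icc x y).Finite) (h1 : x < r) (h2 : r ≤ y) :
    ∃ s, s ⋖ r ∧ x ≤ s := by
  obtain ⟨s, hs, hmax⟩ := Set.exists_max_image (Set.Ico x r) id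
    (hfin.subset fun t ht => ⟨ht.1, ht.2.le.trans h2⟩) ⟨x, le_rfl, h1⟩
  exact ⟨s, ⟨hs.2, fun t h3 h4 => (hmax t ⟨hs.1.trans h3.le, h4⟩).not_gt h3⟩, hs.1⟩

theorem exists_increasing {x y : X} (hfin : (Set.Icc x y).Finite) {m : ℕ}
    (hm : m < (Set.Icc x y).ncard) :
    ∃ f : ℕ → X, (∀ i, f i ∈ Set.Icc x y) ∧ ∀ i j, i < j → j ≤ m → f i < f j := by
  have hcard : hfin.toFinset.card = (Set.Icc x y).ncard := (Set.ncard_eq_toFinset_card _ hfin).symm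
  let e := hfin.toFinset.orderEmbOfFin hcard
  refine ⟨fun i => e ⟨min i m, by omega⟩, fun i => ?_, fun i j hij hj => ?_⟩
  · exact hfin.mem_toFinset.1 (Finset.orderEmbOfFin_mem _ hcard _)
  · exact e.lt_iff_lt.2 (Fin.mk_lt_mk.2 (by omega))

/-- The ultrapower of a linear order. -/
abbrev OrderUltrapower (X : Type u) : Type u := (hyperfilter ℕ : Filter ℕ).Germ X

theorem germ_covBy {f g : ℕ → X} (h : ∀ᶠ i in (hyperfilter ℕ : Filter ℕ), f i ⋖ g i) :
    (f : OrderUltrapower X) ⋖ g := by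
  refine ⟨Germ.coe_lt.2 (h.mono fun i hi => hi.lt), fun c hc1 hc2 => ?_⟩
  obtain ⟨c, rfl⟩ : ∃ b : ℕ → X, (b : OrderUltrapower X) = c := ⟨_, coe_germRep _⟩
  obtain ⟨i, hi, h1, h2⟩ := (h.and ((Germ.coe_lt.1 hc1).and (Germ.coe_lt.1 hc2))).exists
  exact hi.2 h1 h2

/-- The ultraproduct of the finite intervals inherits both ends and immediate neighbours. The points
number `0`, `m`, `2 * m`, `3 * m`, `4 * m` of the `m`-th interval become five points with infinite
gaps; they supply `c₀`, `d`, `c`, `d'` and a bound for the last gap. -/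
theorem exists_movable_of_unbounded
    (h : ∀ m : ℕ, ∃ x y : X, (Set.Icc x y).Finite ∧ m < (Set.Icc x y).ncard) :
    ∃ (a b : OrderUltrapower X) (_ : Nonempty (Set.Icc a b)) (d d' : Set.Icc a b),
      Movable d d' := by
  choose x y hfin hcard using fun m => h (4 * m)
  choose f hf hmono using fun m => exists_increasing (hfin m) (hcard m)
  let a : OrderUltrapower X := (x : OrderUltrapower X)
  let b : OrderUltrapower X := (y : OrderUltrapower X)
  have hmem : ∀ g : ℕ → ℕ, ((fun m => f m (g m) : ℕ → X) : OrderUltrapower X) ∈ Set.Icc a b :=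
    fun g => ⟨Germ.coe_le.2 (.of_forall fun m => (hf m _).1),
      Germ.coe_le.2 (.of_forall fun m => (hf m _).2)⟩
  let p : (ℕ → ℕ) → Set.Icc a b := fun g => ⟨_, hmem g⟩
  have hp : ∀ g g' : ℕ → ℕ, (∀ᶠ m in (hyperfilter ℕ : Filter ℕ), g m < g' m ∧ g' m ≤ 4 * m) →
      p g < p g' := fun g g' hgg' =>
    Subtype.mk_lt_mk.2 (Germ.coe_lt.2 (hgg'.mono fun m hm => hmono m _ _ hm.1 hm.2))
  have hlarge : ∀ t, ∀ᶠ m in (hyperfilter ℕ : Filter ℕ), t < m := fun t =>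
    Nat.hyperfilter_le_atTop (eventually_gt_atTop t)
  have hgap : ∀ j < 4, gapCard (p fun m => j * m) (p fun m => (j + 1) * m) = ⊤ := by
    intro j hj
    -- For each fixed `t`, the germ of `j * m + t` lies in the gap, because `t < m` for almost all
    -- `m`.
    refine Set.encard_eq_top_iff.2 (Set.infinite_of_injective_forall_mem
      (f := fun t : ℕ => p fun m => j * m + t) ?_ ?_)
    · refine (strictMono_nat_of_lt_succ fun t => hp _ _ ?_).injective
      filter_upwards [hlarge (t + 1)] with m hm
      have : j * m ≤ 3 * m := Nat.mul_le_mul_right m (by omega)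
      omega
    · intro t
      constructor
      · rcases Nat.eq_zero_or_pos t with rfl | ht
        · exact le_rfl
        · refine (hp _ _ ?_).le
          filter_upwards [hlarge t] with m hm
          have : j * m ≤ 3 * m := Nat.mul_le_mul_right m (by omega)
          omega
      · refine hp _ _ ?_
        filter_upwards [hlarge t] with m hm
        have : j * m ≤ 3 * m := Nat.mul_le_mul_right m (by omega)
        rw [Nat.succ_mul]
        omega
  have hab : a ≤ b := (p fun _ => 0).2.1.trans (p fun _ => 0).2.2
  have hne : Nonempty (Set.Icc a b) := ⟨⟨a, le_rfl, hab⟩⟩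
  refine ⟨a, b, hne, p fun m => 1 * m, p fun m => 3 * m,
    movable_of_discrete (m := ⟨a, le_rfl, hab⟩) (M := ⟨b, hab, le_rfl⟩) (fun z => z.2.1)
      (fun z => z.2.2) ?_ ?_ (hgap 0 (by omega)) (hgap 1 (by omega)) (hgap 2 (by omega)) ?_⟩
  · rintro ⟨r, hr1, hr2⟩ hne
    have hlt : r < b := hr2.lt_of_ne fun h => hne (Subtype.ext h)
    obtain ⟨r, rfl⟩ : ∃ g : ℕ → X, (g : OrderUltrapower X) = r := ⟨_, coe_germRep _⟩
    -- Coordinates where `r m` leaves the interval are negligible and receive an arbitrary value.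
    have key : ∀ m, ∃ s, x m ≤ r m → r m < y m → r m ⋖ s ∧ s ≤ y m := fun m => by
      by_cases hm : x m ≤ r m ∧ r m < y m
      · obtain ⟨s, hs⟩ := exists_covBy_right (hfin m) hm.1 hm.2
        exact ⟨s, fun _ _ => hs⟩
      · exact ⟨x m, fun h1 h2 => absurd ⟨h1, h2⟩ hm⟩
    choose s hs using key
    have hev : ∀ᶠ m in (hyperfilter ℕ : Filter ℕ), r m ⋖ s m ∧ s m ≤ y m := by
      filter_upwards [Germ.coe_le.1 hr1, Germ.coe_lt.1 hlt] with m h1 h2 using hs m h1 h2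
    have hcov := germ_covBy (hev.mono fun _ h => h.1)
    have hsb : (s : OrderUltrapower X) ≤ b := Germ.coe_le.2 (hev.mono fun _ h => h.2)
    exact ⟨⟨s, hr1.trans hcov.le, hsb⟩, hcov.lt, fun c h1 h2 => hcov.2 h1 h2⟩
  · rintro ⟨r, hr1, hr2⟩ hne
    have hlt : a < r := hr1.lt_of_ne fun h => hne (Subtype.ext h.symm)
    obtain ⟨r, rfl⟩ : ∃ g : ℕ → X, (g : OrderUltrapower X) = r := ⟨_, coe_germRep _⟩
    have key : ∀ m, ∃ s, x m < r m → r m ≤ y m → s ⋖ r m ∧ x m ≤ s := fun m => by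
      by_cases hm : x m < r m ∧ r m ≤ y m
      · obtain ⟨s, hs⟩ := exists_covBy_left (hfin m) hm.1 hm.2
        exact ⟨s, fun _ _ => hs⟩
      · exact ⟨x m, fun h1 h2 => absurd ⟨h1, h2⟩ hm⟩
    choose s hs using key
    have hev : ∀ᶠ m in (hyperfilter ℕ : Filter ℕ), s m ⋖ r m ∧ x m ≤ s m := by
      filter_upwards [Germ.coe_lt.1 hlt, Germ.coe_le.1 hr2] with m h1 h2 using hs m h1 h2
    have hcov := germ_covBy (hev.mono fun _ h => h.1)
    have hsa : a ≤ (s : OrderUltrapower X) := Germ.coe_le.2 (hev.mono fun _ h => h.2)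
    exact ⟨⟨s, hsa, hcov.le.trans hr2⟩, hcov.lt, fun c h1 h2 => hcov.2 h1 h2⟩
  · exact top_le_iff.1 (hgap 3 (by omega) ▸ gapCard_mono le_rfl (p _).2.2)

end Unbounded

end Lang

end ManySorted

/-! ### Interpretations of orders -/

namespace ManySorted

open Filter

namespace Lang

variable {L : Lang.{u}}

/-- An interpretation of a strict order, with the two blocks of variables of the definitions of
equality and of the order given as a sum. -/
structure OrderInterp (M : L.Str) (X : Type u) [LT X] where
  ctx : List L.Srt
  dom : Set (M.Tuple (Var ctx))
  coord : M.Tuple (Var ctx) → X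
  surj : ∀ y, ∃ e ∈ dom, coord e = y
  dom_def : M.IsDefinable dom
  eq_def : M.IsDefinable {e : M.Tuple fun s => Var ctx s ⊕ Var ctx s |
    (fun s x => e s (.inl x)) ∈ dom ∧ (fun s x => e s (.inr x)) ∈ dom ∧
      coord (fun s x => e s (.inl x)) = coord (fun s x => e s (.inr x))}
  lt_def : M.IsDefinable {e : M.Tuple fun s => Var ctx s ⊕ Var ctx s |
    (fun s x => e s (.inl x)) ∈ dom ∧ (fun s x => e s (.inr x)) ∈ dom ∧
      coord (fun s x => e s (.inl x)) < coord (fun s x => e s (.inr x))}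

/-- Two blocks of variables, as a sum. -/
def Blocks.toSum {S S' : Type u} {ctx : S' → List S} {t : S'} (s : S) :
    Blocks ctx [t, t] s → Var (ctx t) s ⊕ Var (ctx t) s
  | ⟨_, .zero, y⟩ => .inl y
  | ⟨_, .succ .zero, y⟩ => .inr y

theorem forall_var_pair {S : Type u} {s : S} {P : ∀ t, Var [s, s] t → Prop} :
    (∀ t x, P t x) ↔ P s .zero ∧ P s (.succ .zero) := by
  refine ⟨fun h => ⟨h _ _, h _ _⟩, fun h t x => ?_⟩
  match t, x with
  | _, .zero => exact h.1
  | _, .succ .zero => exact h.2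

/-- The sort of the language of orders. -/
def orderSort : order.{u}.Srt := PUnit.unit

/-- The order symbol. -/
def orderLt : order.{u}.Rel [orderSort, orderSort] := OrderRel.lt

/-- The simplified form of an interpretation of an order. -/
def Interpretation.toOrderInterp {M : L.Str} {X : Type u} [LT X] [Nonempty X]
    (ι : Interpretation M (orderStr X)) : OrderInterp M X where
  ctx := ι.ctx orderSort
  dom := ι.dom orderSort
  coord := ι.coord orderSort
  surj := ι.surj orderSort
  dom_def := ι.dom_def orderSort
  eq_def := by
    have h := (ι.eq_def orderSort).reindex Blocks.toSum
    simp only [Set.mem_ofPred_eq, forall_var_pair, and_assoc] at h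
    exact h
  lt_def := by
    have h := (ι.rel_def [orderSort, orderSort] orderLt).reindex Blocks.toSum
    simp only [Set.mem_ofPred_eq, forall_var_pair, and_assoc] at h
    exact h

/-! ### Ultrapowers of interpretations -/

/-- By Łoś's theorem the same formula works, with its parameters moved along the diagonal. -/
theorem Str.IsDefinable.ultrapower {M : L.Str} {V : L.Srt → Type u} {X : Set (M.Tuple V)}
    (h : M.IsDefinable X) : M.ultrapower.IsDefinable {e : M.ultrapower.Tuple V |
      ∀ᶠ i in (hyperfilter ℕ : Filter ℕ), (fun s x => germRep (e s x) i : M.Tuple V) ∈ X} := by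
  obtain ⟨Γ, φ, σ, h⟩ := h
  refine ⟨Γ, φ, fun s x => (σ s x).map id (M.diag s), fun e => ?_⟩
  have : (fun s x => Sum.elim (e s) id ((σ s x).map id (M.diag s)) :
      M.ultrapower.Tuple (Var Γ)) =
      M.germs fun s x i => Sum.elim (fun v => germRep (e s v) i) id (σ s x) := by
    funext s x
    simp only [Str.germs]
    rcases σ s x with v | m
    · exact (coe_germRep (e s v)).symm
    · rfl
  rw [this, Formula.realize_germs]
  exact eventually_congr (.of_forall fun i => h _)

/-- The ultrapower of an interpretation of a linear order. -/
noncomputable def OrderInterp.ultrapower {M : L.Str} {X : Type u} [LinearOrder X]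
    (o : OrderInterp M X) : OrderInterp M.ultrapower (OrderUltrapower X) where
  ctx := o.ctx
  dom := {e | ∀ᶠ i in (hyperfilter ℕ : Filter ℕ), (fun s x => germRep (e s x) i) ∈ o.dom}
  coord e := ((fun i => o.coord fun s x => germRep (e s x) i : ℕ → X) : OrderUltrapower X)
  surj y := by
    obtain ⟨y, rfl⟩ : ∃ g : ℕ → X, (g : OrderUltrapower X) = y := ⟨_, coe_germRep _⟩
    choose e he hy using fun i => o.surj (y i)
    refine ⟨M.germs fun s x i => e i s x, ?_, Germ.coe_eq.2 ?_⟩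
    · filter_upwards [M.eventually_germRep_germs fun s x i => e i s x] with i hi
      rw [hi]
      exact he i
    · filter_upwards [M.eventually_germRep_germs fun s x i => e i s x] with i hi
      rw [hi]
      exact hy i
  dom_def := o.dom_def.ultrapower
  eq_def := by
    convert o.eq_def.ultrapower using 1
    ext e
    simp only [Set.mem_ofPred_eq, eventually_and]
    exact and_congr_right fun _ => and_congr_right fun _ => Germ.coe_eq
  lt_def := by
    convert o.lt_def.ultrapower using 1
    ext e
    simp only [Set.mem_ofPred_eq, eventually_and]
    exact and_congr_right fun _ => and_congr_right fun _ => Germ.coe_lt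

/-! ### Definability in an interpreted order -/

namespace OrderInterp

/-- Elements of `X` coding the labels. -/
noncomputable def code {X : Type u} [Infinite X] (n : circ.{u}.Srt)
    (l : ZMod (2 * n.down + 2)) : X :=
  Infinite.natEmbedding X l.val

theorem code_injective {X : Type u} [Infinite X] (n : circ.{u}.Srt) :
    Function.Injective (code (X := X) n) :=
  (Infinite.natEmbedding X).injective.comp (ZMod.val_injective _)

variable {M : L.Str} {X : Type u} [LinearOrder X] (o : OrderInterp M X) {W : L.Srt → Type u}

/-- A set of elements of the interpreted order is definable in the interpreting structure. -/
def IsDef (J : Set X) : Prop := M.IsDefinable {e | e ∈ o.dom ∧ o.coord e ∈ J}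

theorem isDefinable_eq (q q' : ∀ s, Var o.ctx s → W s) : M.IsDefinable {e : M.Tuple W |
    (fun s x => e s (q s x)) ∈ o.dom ∧ (fun s x => e s (q' s x)) ∈ o.dom ∧
      o.coord (fun s x => e s (q s x)) = o.coord (fun s x => e s (q' s x))} :=
  o.eq_def.reindex fun s => Sum.elim (q s) (q' s)

theorem isDefinable_lt (q q' : ∀ s, Var o.ctx s → W s) : M.IsDefinable {e : M.Tuple W |
    (fun s x => e s (q s x)) ∈ o.dom ∧ (fun s x => e s (q' s x)) ∈ o.dom ∧
      o.coord (fun s x => e s (q s x)) < o.coord (fun s x => e s (q' s x))} :=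
  o.lt_def.reindex fun s => Sum.elim (q s) (q' s)

theorem isDef_singleton (p : X) : o.IsDef {p} := by
  obtain ⟨y, hy, rfl⟩ := o.surj p
  have h := o.eq_def.subst (W := Var o.ctx) fun s => Sum.elim .inl fun x => .inr (y s x)
  simp only [Set.mem_ofPred_eq, Sum.elim_inl, Sum.elim_inr, id] at h
  simpa [IsDef, hy] using h

theorem isDef_Iio (p : X) : o.IsDef (Set.Iio p) := by
  obtain ⟨y, hy, rfl⟩ := o.surj p
  have h := o.lt_def.subst (W := Var o.ctx) fun s => Sum.elim .inl fun x => .inr (y s x)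
  simp only [Set.mem_ofPred_eq, Sum.elim_inl, Sum.elim_inr, id] at h
  simpa [IsDef, hy] using h

theorem isDef_Ioi (p : X) : o.IsDef (Set.Ioi p) := by
  obtain ⟨y, hy, rfl⟩ := o.surj p
  have h := o.lt_def.subst (W := Var o.ctx) fun s => Sum.elim (fun x => .inr (y s x)) .inl
  simp only [Set.mem_ofPred_eq, Sum.elim_inl, Sum.elim_inr, id] at h
  simpa [IsDef, hy] using h

variable {o}

theorem IsDef.compl {J : Set X} (h : o.IsDef J) : o.IsDef Jᶜ := by
  unfold IsDef
  convert o.dom_def.inter (Str.IsDefinable.compl h) using 1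
  ext e
  simp only [Set.mem_ofPred_eq, Set.mem_inter_iff, Set.mem_compl_iff]
  tauto

theorem IsDef.inter {J J' : Set X} (h : o.IsDef J) (h' : o.IsDef J') : o.IsDef (J ∩ J') := by
  unfold IsDef
  convert Str.IsDefinable.inter h h' using 1
  ext e
  simp only [Set.mem_ofPred_eq, Set.mem_inter_iff]
  tauto

variable (o)

theorem isDef_Ici (p : X) : o.IsDef (Set.Ici p) := by
  simpa using (o.isDef_Iio p).compl

theorem isDef_Iic (p : X) : o.IsDef (Set.Iic p) := by
  simpa using (o.isDef_Ioi p).compl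

theorem isDef_Icc (a b : X) : o.IsDef (Set.Icc a b) :=
  (o.isDef_Ici a).inter (o.isDef_Iic b)

theorem isDef_Ico (a b : X) : o.IsDef (Set.Ico a b) :=
  (o.isDef_Ici a).inter (o.isDef_Iio b)

theorem isDef_limitPoints : o.IsDef (limitPoints X) := by
  -- With `x` in the first block and `y` in the second, `h1` asks for a point strictly between `y`
  -- and `x`. Then `h2` says that some `y < x` has no such point, and `h3` takes the complement
  -- within `dom`.
  have h1 := ((o.isDefinable_lt (W := fun s => (Var o.ctx s ⊕ Var o.ctx s) ⊕ Var o.ctx s)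
    (fun _ x => .inl (.inr x)) fun _ x => .inr x).inter
    (o.isDefinable_lt (fun _ x => .inr x) fun _ x => .inl (.inl x))).exists_tuple
  have h2 := ((o.isDefinable_lt (W := fun s => Var o.ctx s ⊕ Var o.ctx s)
    (fun _ x => .inr x) fun _ x => .inl x).inter h1.compl).exists_tuple
  have h3 := o.dom_def.inter h2.compl
  unfold IsDef
  convert h3 using 1
  ext e
  simp only [limitPoints, Set.mem_ofPred_eq, Set.mem_inter_iff, Set.mem_compl_iff, Sum.elim_inl,
    Sum.elim_inr, not_exists, not_and]
  refine and_congr_right fun he => ⟨fun H y hy hc => ?_, fun H y hy => ?_⟩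
  · obtain ⟨z, hz1, hz2⟩ := H _ hy.2.2
    obtain ⟨z, hz, rfl⟩ := o.surj z
    exact hc z ⟨hy.1, hz, hz1⟩ hz he hz2
  · obtain ⟨y, hy', rfl⟩ := o.surj y
    by_contra hc
    exact H y ⟨hy', he, hy⟩ fun z hz _ _ hlt => hc ⟨o.coord z, hz.2.2, hlt⟩

/-! ### Interpreting the circles -/

section Circle

variable [Infinite X] (J : Set X)

/-- Pairs of an element of `J` and the code of a label. -/
def circDom (n : circ.{u}.Srt) : Set (M.Tuple (Var (o.ctx ++ o.ctx))) :=
  {e | ((fun s x => e s x.inl) ∈ o.dom ∧ o.coord (fun s x => e s x.inl) ∈ J) ∧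
    ∃ l, (fun s x => e s x.inr) ∈ o.dom ∧ o.coord (fun s x => e s x.inr) = code n l}

variable {o J} in
theorem isDefinable_circDom (hJ : o.IsDef J) (n : circ.{u}.Srt) :
    M.IsDefinable (o.circDom J n) := by
  have h1 := Str.IsDefinable.reindex (W := Var (o.ctx ++ o.ctx)) hJ fun _ x => x.inl
  have h2 := Str.IsDefinable.iUnion fun l : ZMod (2 * n.down + 2) =>
    Str.IsDefinable.reindex (W := Var (o.ctx ++ o.ctx)) (o.isDef_singleton (code n l))
      fun _ x => x.inr
  convert h1.inter h2 using 1
  ext e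
  simp [circDom]

variable [Nonempty J]

open Classical in
/-- The point of the circle coded by a tuple. -/
noncomputable def circCoord (n : circ.{u}.Srt) (e : M.Tuple (Var (o.ctx ++ o.ctx))) :
    J × ZMod (2 * n.down + 2) :=
  -- The default point of `J` is taken only outside `circDom`, where coordinates do not matter.
  (if h : o.coord (fun s x => e s x.inl) ∈ J then ⟨_, h⟩ else Classical.arbitrary J,
    Function.invFun (code n) (o.coord fun s x => e s x.inr))

variable {o J}

theorem circCoord_fst {n : circ.{u}.Srt} {e : M.Tuple (Var (o.ctx ++ o.ctx))}
    (he : e ∈ o.circDom J n) :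
    ((o.circCoord J n e).1 : X) = o.coord fun s x => e s x.inl := by
  simp only [circCoord, dif_pos he.1.2]

theorem circCoord_snd {n : circ.{u}.Srt} {e : M.Tuple (Var (o.ctx ++ o.ctx))}
    (he : e ∈ o.circDom J n) (l : ZMod (2 * n.down + 2)) :
    (o.circCoord J n e).2 = l ↔ o.coord (fun s x => e s x.inr) = code n l := by
  obtain ⟨l', -, hl'⟩ := he.2
  simp only [circCoord, hl', Function.leftInverse_invFun (code_injective n) l',
    (code_injective n).eq_iff]

theorem circCoord_eq_iff {n : circ.{u}.Srt} {e e' : M.Tuple (Var (o.ctx ++ o.ctx))}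
    (he : e ∈ o.circDom J n) (he' : e' ∈ o.circDom J n) :
    o.circCoord J n e = o.circCoord J n e' ↔
      o.coord (fun s x => e s x.inl) = o.coord (fun s x => e' s x.inl) ∧
        o.coord (fun s x => e s x.inr) = o.coord (fun s x => e' s x.inr) := by
  rw [Prod.ext_iff, Subtype.ext_iff, circCoord_fst he, circCoord_fst he', circCoord_snd he,
    (circCoord_snd he' _).1 rfl]

/-- Addition of labels need not be definable from the order. There are only finitely many labels,
each coded by a parameter, so the relation becomes a finite disjunction over the label of the first
point. -/
theorem circCoord_relMap_iff {n : circ.{u}.Srt} {e e' : M.Tuple (Var (o.ctx ++ o.ctx))}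
    (he : e ∈ o.circDom J n) (he' : e' ∈ o.circDom J n) :
    (((o.circCoord J n e').2 = (o.circCoord J n e).2 ∧
        (o.circCoord J n e).1 ≤ (o.circCoord J n e').1) ∨
      ((o.circCoord J n e').2 = (o.circCoord J n e).2 + 1 ∧
        (o.circCoord J n e').1 < (o.circCoord J n e).1)) ↔
    ∃ l, o.coord (fun s x => e s x.inr) = code n l ∧
      ((o.coord (fun s x => e' s x.inr) = code n l ∧
          ¬ o.coord (fun s x => e' s x.inl) < o.coord (fun s x => e s x.inl)) ∨
        (o.coord (fun s x => e' s x.inr) = code n (l + 1) ∧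
          o.coord (fun s x => e' s x.inl) < o.coord (fun s x => e s x.inl))) := by
  rw [← Subtype.coe_le_coe, ← Subtype.coe_lt_coe, circCoord_fst he, circCoord_fst he',
    circCoord_snd he', circCoord_snd he', ← not_lt]
  constructor
  · exact fun H => ⟨_, (circCoord_snd he _).1 rfl, H⟩
  · rintro ⟨l, hl, H⟩
    obtain rfl := (circCoord_snd he l).2 hl
    exact H

variable (o J)

/-- The structure of circles over a definable set is interpreted. -/
noncomputable def circInterpretation (hJ : o.IsDef J) : Interpretation M (circStr J) where
  ctx _ := o.ctx ++ o.ctx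
  dom n := o.circDom J n
  coord n := o.circCoord J n
  surj n := by
    rintro ⟨⟨x, hx⟩, l⟩
    obtain ⟨y, hy, rfl⟩ := o.surj x
    obtain ⟨z, hz, hzl⟩ := o.surj (code n l)
    have he : M.append y z ∈ o.circDom J n := by
      simp only [circDom, Set.mem_ofPred_eq, Str.append_inl, Str.append_inr]
      exact ⟨⟨hy, hx⟩, l, hz, hzl⟩
    refine ⟨_, he, Prod.ext (Subtype.ext ?_) ((circCoord_snd he l).2 ?_)⟩
    · rw [circCoord_fst he]
      simp only [Str.append_inl]
    · simp only [Str.append_inr, hzl]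
  dom_def n := isDefinable_circDom hJ n
  eq_def n := by
    have hd := isDefinable_circDom hJ n
    let W := Blocks (fun _ : circ.{u}.Srt => o.ctx ++ o.ctx) [n, n]
    have d0 := hd.reindex (W := W) fun _ x => ⟨n, .zero, x⟩
    have d1 := hd.reindex (W := W) fun _ x => ⟨n, .succ .zero, x⟩
    have he := o.isDefinable_eq (W := W) (fun _ x => ⟨n, .zero, x.inl⟩)
      fun _ x => ⟨n, .succ .zero, x.inl⟩
    have hl := o.isDefinable_eq (W := W) (fun _ x => ⟨n, .zero, x.inr⟩)
      fun _ x => ⟨n, .succ .zero, x.inr⟩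
    convert (d0.inter d1).inter (he.inter hl) using 1
    ext e
    simp only [Set.mem_ofPred_eq, Set.mem_inter_iff, forall_var_pair]
    refine and_congr_right fun ⟨h0, h1⟩ => ?_
    refine (circCoord_eq_iff h0 h1).trans ⟨fun H => ?_, fun H => ⟨H.1.2.2, H.2.2.2⟩⟩
    exact ⟨⟨h0.1.1, h1.1.1, H.1⟩, h0.2.choose_spec.1, h1.2.choose_spec.1, H.2⟩
  rel_def ar R := by
    suffices main : ∀ n : circ.{u}.Srt, M.IsDefinable
        {e : M.Tuple (Blocks (fun _ : circ.{u}.Srt => o.ctx ++ o.ctx) [n, n]) |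
          (∀ t x, M.block e t x ∈ o.circDom J t) ∧
            (circStr J).relMap (arc n) fun t x => o.circCoord J t (M.block e t x)} by
      cases R with
      | arc n => exact main n
    intro n
    have hd := isDefinable_circDom hJ n
    let W := Blocks (fun _ : circ.{u}.Srt => o.ctx ++ o.ctx) [n, n]
    have d0 := hd.reindex (W := W) fun _ x => ⟨n, .zero, x⟩
    have d1 := hd.reindex (W := W) fun _ x => ⟨n, .succ .zero, x⟩
    have hlt := o.isDefinable_lt (W := W) (fun _ x => ⟨n, .succ .zero, x.inl⟩)
      fun _ x => ⟨n, .zero, x.inl⟩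
    have l0 := fun l => Str.IsDefinable.reindex (W := W) (o.isDef_singleton (code n l))
      fun _ x => ⟨n, .zero, x.inr⟩
    have l1 := fun l => Str.IsDefinable.reindex (W := W) (o.isDef_singleton (code n l))
      fun _ x => ⟨n, .succ .zero, x.inr⟩
    have hU := Str.IsDefinable.iUnion fun l : ZMod (2 * n.down + 2) =>
      (l0 l).inter (((l1 l).inter hlt.compl).union ((l1 (l + 1)).inter hlt))
    convert (d0.inter d1).inter hU using 1
    ext e
    simp only [Set.mem_ofPred_eq, Set.mem_inter_iff, forall_var_pair, Set.mem_iUnion, Set.mem_union,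
      Set.mem_compl_iff, Set.mem_singleton_iff]
    refine and_congr_right fun ⟨h0, h1⟩ => ?_
    have m0 := h0.1.1
    have m1 := h1.1.1
    have s0 := h0.2.choose_spec.1
    have s1 := h1.2.choose_spec.1
    refine ((circStr_relMap n _).trans (circCoord_relMap_iff h0 h1)).trans
      (exists_congr fun l => ?_)
    refine and_congr ⟨fun H => ⟨s0, H⟩, fun H => H.2⟩ (or_congr ?_ ?_)
    · exact and_congr ⟨fun H => ⟨s1, H⟩, fun H => H.2⟩
        (not_congr ⟨fun H => ⟨m1, m0, H⟩, fun H => H.2.2⟩)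
    · exact and_congr ⟨fun H => ⟨s1, H⟩, fun H => H.2⟩
        ⟨fun H => ⟨m1, m0, H⟩, fun H => H.2.2⟩
  fun_def _ _ f := isEmptyElim f

end Circle

end OrderInterp

theorem not_isHereditarilyGCompact_of_movable {T : L.Theory} {M : L.Str} (hM : M.IsModel T)
    {X : Type u} [LinearOrder X] [Infinite X] (o : OrderInterp M X) {J : Set X} (hJ : o.IsDef J)
    [Nonempty J] {d d' : J} (h : Movable d d') : ¬ T.IsHereditarilyGCompact := fun H =>
  circStr_not_isGCompact h (H M hM circ (circStr J) ⟨o.circInterpretation J hJ⟩)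

end Lang

end ManySorted

theorem theorem4 {L : ManySorted.Lang.{u}} (T : L.Theory)
    (hT : T.InterpretsInfiniteLinearOrder) : ¬ T.IsHereditarilyGCompact := by
  obtain ⟨M, hM, X, _, _, ⟨ι⟩⟩ := hT
  let o := ι.toOrderInterp
  -- A uniform bound on finite closed intervals leads to the dense case; its failure leads to the
  -- discrete case.
  by_cases h : ∃ K : ℕ, ∀ x y : X, (Set.Icc x y).Finite → (Set.Icc x y).ncard ≤ K
  · obtain ⟨K, hK⟩ := h
    obtain ⟨a, b, _, d, d', hd⟩ := ManySorted.Lang.exists_movable_of_bounded hK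
    exact ManySorted.Lang.not_isHereditarilyGCompact_of_movable hM o
      (o.isDef_limitPoints.inter (o.isDef_Ico a b)) hd
  · push Not at h
    obtain ⟨a, b, _, d, d', hd⟩ := ManySorted.Lang.exists_movable_of_unbounded h
    -- Infinity of the ultrapower is needed to code the labels; constant sequences give it.
    have : Infinite (ManySorted.Lang.OrderUltrapower X) :=
      Infinite.of_injective (fun x : X => ((fun _ => x : ℕ → X) :
        ManySorted.Lang.OrderUltrapower X)) fun x y hxy => by
          obtain ⟨_, hi⟩ := (Filter.Germ.coe_eq.1 hxy).exists
          exact hi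
    exact ManySorted.Lang.not_isHereditarilyGCompact_of_movable
      ((M.diag_isElementary.isModel_iff T).2 hM) o.ultrapower (o.ultrapower.isDef_Icc a b) hd
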